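/- Let $\mathbb F_q$ be the finite field with $q$ elements, of characteristic $p$. For $A=\begin{pmatrix}a&b\\c&d\end{pmatrix}\in \mathrm{GL}_2(\mathbb F_q)$ and $f\in\mathbb F_q[x]$ of degree $k$ put $A\circ f=(bx+d)^k f\!\left(\frac{ax+c}{bx+d}\right)$, and for $f\neq 0$ let $[A]\circ f$ be the monic scalar multiple of $A\circ f$; it depends only on the class $[A]\in \mathrm{PGL}_2(\mathbb F_q)$. A monic irreducible polynomial $f$ of degree at least $2$ is called $[A]$-invariant if $[A]\circ f=f$. For polynomials $g,h$ with $h\ne 0$ and $F\in\mathbb F_q[x]$ of degree $m$ put $F^{g/h}=h^mF(g/h)$. We say that $A$ has type $0$ if $[A]=[I]$; otherwise $A$ has type $1$, $2$, $3$, $4$ if its eigenvalues are, respectively, distinct and in $\mathbb F_q$; equal and in $\mathbb F_q$; of the form $\alpha,-\alpha$ with $\alpha\in\mathbb F_{q^2}\setminus\mathbb F_q$; in $\mathbb F_{q^2}\setminus\mathbb F_q$ and not of the form $\alpha,-\alpha$. Let $D$ be the order of $[A]$ in $\mathrm{PGL}_2(\mathbb F_q)$. The reduced matrices $R$ of each type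 and their pairs $(g_R,h_R)$ are: - type $0$: $R=I$, $(g_R,h_R)=(x,1)$; - type $1$: $R=\begin{pmatrix}a&0\\0&1\end{pmatrix}$ with $a\in\mathbb F_q\setminus\{0,1\}$, $(g_R,h_R)=(x^D,1)$; - type $2$: $R=\begin{pmatrix}1&0\\1&1\end{pmatrix}$, $(g_R,h_R)=(x^p-x,1)$; - type $3$: $R=\begin{pmatrix}0&1\\b&0\end{pmatrix}$ with $b\in\mathbb F_q$ a non-square, $(g_R,h_R)=(x^2+b,x)$; - type $4$: $R=\begin{pmatrix}0&1\\c&1\end{pmatrix}$ with $x^2-x-c$ irreducible over $\mathbb F_q$, $g_R=\dfrac{\theta^q(x+\theta^q)^D-\theta(x+\theta)^D}{\theta^q-\theta}$, $h_R=\dfrac{(x+\theta^q)^D-(x+\theta)^D}{\theta^q-\theta}$, where $\theta$ is a root of $x^2-x-c$ (these polynomials lie in $\mathbb F_q[x]$). An explicit pair for $A$ of type $t$ is a pair $(g_A,h_A)$ of the form $$g_A=(w_3x+w_4)^D g_R\!\left(\tfrac{w_1x+w_2}{w_3x+w_4}\right),\qquad h_A=(w_3x+w_4)^D h_R\!\left(\tfrac{w_1x+w_2}{w_3x+w_4}\right),$$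 where $R$ is a reduced matrix of type $t$ and $P=\begin{pmatrix}w_1&w_3\\w_2&w_4\end{pmatrix}\in\mathrm{GL}_2(\mathbb F_q)$ is such that $[A]=[P][R][P]^{-1}$. **Theorem.** Let $A\in\mathrm{GL}_2(\mathbb F_q)$ and let $D$ be the order of $[A]$ in $\mathrm{PGL}_2(\mathbb F_q)$. 1. $A$ has some type $t$, and there is an explicit pair $(g_A,h_A)$ for $A$ of type $t$ such that $g_A,h_A$ are relatively prime, $\max(\deg g_A,\deg h_A)=D$ (so $Q_A=g_A/h_A$ is a rational function of degree $D$), and for every integer $m$ with $Dm>2$ the $[A]$-invariants of degree $Dm$ are exactly the monic irreducible polynomials of the form $F^{Q_A}=h_A^m F(g_A/h_A)$ with $F\in\mathbb F_q[x]$ of degree $m$. 2. For every explicit pair $(g_A,h_A)$ for $A$, of any type, $g_A$ and $h_A$ are relatively prime, $\max(\deg g_A,\deg h_A)=D$, and for every integer $m$ with $Dm>2$ and every monic irreducible $f\in\mathbb F_q[x]$ of degree $Dm$, one has $[A]\circ f=f$ if and only if $f=h_A^mF(g_A/h_A)$ for some $F\in\mathbb F_q[x]$ of degree $m$. -/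

import Mathlib

open Polynomial

/-- `homogAt n f u v = ∑ i ≤ n, aᵢ uⁱ vⁿ⁻ⁱ` where `f = ∑ aᵢ xⁱ`; if `deg f ≤ n` and `v ≠ 0` this is the
polynomial `vⁿ f(u / v)` (see `algebraMap_homogAt`). -/
noncomputable def homogAt {F : Type*} [Field F] (n : ℕ) (f u v : F[X]) : F[X] :=
  ∑ i ∈ Finset.range (n + 1), C (f.coeff i) * u ^ i * v ^ (n - i)

theorem algebraMap_homogAt {F : Type*} [Field F] (n : ℕ) (f u v : F[X])
    (hf : f.natDegree ≤ n) (hv : v ≠ 0) :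
    algebraMap F[X] (RatFunc F) (homogAt n f u v) =
      algebraMap F[X] (RatFunc F) v ^ n *
        aeval (algebraMap F[X] (RatFunc F) u / algebraMap F[X] (RatFunc F) v) f := by
  have hv' : algebraMap F[X] (RatFunc F) v ≠ 0 := by
    simpa using hv
  rw [homogAt, map_sum, aeval_eq_sum_range' (Nat.lt_succ_of_le hf), Finset.mul_sum]
  refine Finset.sum_congr rfl fun i hi => ?_
  have hi' : i ≤ n := Nat.lt_succ_iff.mp (Finset.mem_range.mp hi)
  obtain ⟨k, rfl⟩ := Nat.exists_eq_add_of_le hi'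
  rw [Nat.add_sub_cancel_left, map_mul, map_mul, map_pow, map_pow, Algebra.smul_def, div_pow,
    pow_add, IsScalarTower.algebraMap_apply F F[X] (RatFunc F), Polynomial.algebraMap_eq]
  field_simp

/-- For `A = (a b; c d)`: the form `ax + c`. -/
noncomputable def topForm {F : Type*} [Field F] (A : GL (Fin 2) F) : F[X] :=
  C (A.1 0 0) * X + C (A.1 1 0)

/-- For `A = (a b; c d)`: the form `bx + d`. -/
noncomputable def botForm {F : Type*} [Field F] (A : GL (Fin 2) F) : F[X] :=
  C (A.1 0 1) * X + C (A.1 1 1)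

/-- `A ∘ f = (bx + d)ᵏ f((ax + c) / (bx + d))`, where `A = (a b; c d)` and `k = deg f`. -/
noncomputable def glComp {F : Type*} [Field F] (A : GL (Fin 2) F) (f : F[X]) : F[X] :=
  homogAt f.natDegree f (topForm A) (botForm A)

/-- The projective general linear group `PGL₂(F)`. -/
abbrev PGL2 (F : Type*) [Field F] : Type _ :=
  GL (Fin 2) F ⧸ Subgroup.center (GL (Fin 2) F)

/-- The class `[A]` of `A` in `PGL₂(F)`. -/
def pglMk {F : Type*} [Field F] (A : GL (Fin 2) F) : PGL2 F := QuotientGroup.mk A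

/-- The monic scalar multiple of a nonzero polynomial. -/
noncomputable def monicPart {F : Type*} [Field F] (f : F[X]) : F[X] := C f.leadingCoeff⁻¹ * f

theorem monicPart_glComp_eq {F : Type*} [Field F] {A B : GL (Fin 2) F}
    (h : A⁻¹ * B ∈ Subgroup.center (GL (Fin 2) F)) (f : F[X]) :
    monicPart (glComp A f) = monicPart (glComp B f) := by
  obtain ⟨c, hc, hB⟩ : ∃ c : F, c ≠ 0 ∧ ∀ i j, B.1 i j = A.1 i j * c := by
    rw [Matrix.GeneralLinearGroup.center_eq_range_scalar] at h
    obtain ⟨c, hc⟩ := h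
    refine ⟨c, c.ne_zero, fun i j => ?_⟩
    have hBA : B = A * Matrix.GeneralLinearGroup.scalar (Fin 2) c := by rw [hc]; group
    rw [hBA]
    change (A.1 * Matrix.scalar (Fin 2) (c : F)) i j = _
    simp [Matrix.scalar_apply, Matrix.mul_diagonal]
  have ht : topForm B = C c * topForm A := by simp only [topForm, hB, C_mul]; ring
  have hb : botForm B = C c * botForm A := by simp only [botForm, hB, C_mul]; ring
  have hg : glComp B f = C (c ^ f.natDegree) * glComp A f := by
    rw [glComp, glComp, homogAt, homogAt, Finset.mul_sum]
    refine Finset.sum_congr rfl fun i hi => ?_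
    have hi' : i ≤ f.natDegree := Nat.lt_succ_iff.mp (Finset.mem_range.mp hi)
    obtain ⟨k, hk⟩ := Nat.exists_eq_add_of_le hi'
    rw [ht, hb, hk, Nat.add_sub_cancel_left, C_pow]
    ring
  have hcn : c ^ f.natDegree ≠ 0 := pow_ne_zero _ hc
  rw [hg, monicPart, monicPart, leadingCoeff_mul, leadingCoeff_C, mul_inv, ← mul_assoc,
    ← C_mul, mul_right_comm, inv_mul_cancel₀ hcn, one_mul]

/-- The composition `[A] ∘ f` for `[A] ∈ PGL₂(F)`: the monic scalar multiple of `A ∘ f`. -/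
noncomputable def pglComp {F : Type*} [Field F] (α : PGL2 F) (f : F[X]) : F[X] :=
  Quotient.liftOn' α (fun A => monicPart (glComp A f)) fun _ _ h =>
    monicPart_glComp_eq (QuotientGroup.leftRel_apply.mp h) f

/-- `f` is a monic irreducible `α`-invariant polynomial of degree `n`. -/
def IsInvariantOfDegree {F : Type*} [Field F] (α : PGL2 F) (n : ℕ) (f : F[X]) : Prop :=
  f.Monic ∧ Irreducible f ∧ f.natDegree = n ∧ pglComp α f = f

/-- `f = hᵐ G(g / h)` for some polynomial `G` of degree `m`. -/
def IsTransform {F : Type*} [Field F] (g h : F[X]) (m : ℕ) (f : F[X]) : Prop :=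
  ∃ G : F[X], G.natDegree = m ∧ f = homogAt m G g h

/-- The type of a class `[A]`; `zero` stands for `[A] = [I]`. -/
inductive PGLType
  | zero
  | one
  | two
  | three
  | four

/-- The type of `A`, read off from its eigenvalues. -/
def HasType {F : Type*} [Field F] (A : GL (Fin 2) F) : PGLType → Prop
  | .zero => pglMk A = 1
  | .one => ∃ α β : F, α ≠ β ∧ A.1.charpoly = (X - C α) * (X - C β)
  | .two => pglMk A ≠ 1 ∧ ∃ α : F, A.1.charpoly = (X - C α) ^ 2
  | .three => ∃ α : AlgebraicClosure F, α ∉ Set.range (algebraMap F (AlgebraicClosure F)) ∧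
      A.1.charpoly.map (algebraMap F (AlgebraicClosure F)) = (X - C α) * (X - C (-α))
  | .four => ∃ α β : AlgebraicClosure F, α ∉ Set.range (algebraMap F (AlgebraicClosure F)) ∧
      β ≠ -α ∧
      A.1.charpoly.map (algebraMap F (AlgebraicClosure F)) = (X - C α) * (X - C β)

/-- `R` is in reduced form of the given type, and `g / h` is the rational function attached to it;
`D` is to be the order of `[R]`. -/
def IsReducedPair {F : Type*} [Field F] (D : ℕ) (R : GL (Fin 2) F) (g h : F[X]) : PGLType → Prop
  | .zero => R = 1 ∧ g = X ∧ h = 1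
  | .one => ∃ a : F, a ≠ 1 ∧ R.1 = !![a, 0; 0, 1] ∧ g = X ^ D ∧ h = 1
  | .two => R.1 = !![1, 0; 1, 1] ∧ g = X ^ ringChar F - X ∧ h = 1
  | .three => ∃ b : F, ¬ IsSquare b ∧ R.1 = !![0, 1; b, 0] ∧ g = X ^ 2 + C b ∧ h = X
  | .four => ∃ c : F, Irreducible (X ^ 2 - X - C c : F[X]) ∧ R.1 = !![0, 1; c, 1] ∧
      ∃ θ : AlgebraicClosure F, θ ^ 2 - θ - algebraMap F (AlgebraicClosure F) c = 0 ∧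
        g.map (algebraMap F (AlgebraicClosure F)) =
          C (θ ^ Nat.card F - θ)⁻¹ *
            (C (θ ^ Nat.card F) * (X + C (θ ^ Nat.card F)) ^ D - C θ * (X + C θ) ^ D) ∧
        h.map (algebraMap F (AlgebraicClosure F)) =
          C (θ ^ Nat.card F - θ)⁻¹ * ((X + C (θ ^ Nat.card F)) ^ D - (X + C θ) ^ D)

/-- `g / h` is the rational function computed from `A` by writing `[A] = [P] [R] [P]⁻¹` with `R` in
reduced form of type `t` and substituting `(w₁x + w₂) / (w₃x + w₄)`, where `P = (w₁ w₃; w₂ w₄)`, in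
the rational function of `R` (numerator and denominator are multiplied by `(w₃x + w₄)ᴰ`). -/
def IsExplicitPair {F : Type*} [Field F] (t : PGLType) (A : GL (Fin 2) F) (g h : F[X]) : Prop :=
  ∃ (R P : GL (Fin 2) F) (g₀ h₀ : F[X]),
    pglMk A = pglMk P * pglMk R * (pglMk P)⁻¹ ∧
    IsReducedPair (orderOf (pglMk A)) R g₀ h₀ t ∧
    g = homogAt (orderOf (pglMk A)) g₀ (topForm P) (botForm P) ∧
    h = homogAt (orderOf (pglMk A)) h₀ (topForm P) (botForm P)

/-!
Let `A = (a b; c d)` act on the projective line by `z ↦ (az + c) / (bz + d)`. The rational function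
`Q = g / h` attached to `A` is invariant under this map and has degree `D`, the order of `[A]`
(`IsInvariantPair`). If `f = hᵐ G(g / h)` then `f` is therefore invariant. Conversely, let `f` be
invariant and irreducible of degree `D m > 2`, and let `α` be a root. A nontrivial power of `[A]`
fixes only points of degree at most two, so the orbit of every root of `f` consists of `D` roots of
`f` (`moebius_pow_injOn`), and `Q` is constant on it. Hence every conjugate of `Q(α)` has at least
`D` preimages among the roots of `f`, and the minimal polynomial `G` of `Q(α)` has degree at most
`m` (`IsInvariantPair.mul_natDegree_minpoly_le`). The nonzero polynomial `h ^ (deg G) G(g / h)`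
vanishes at `α` and has degree at most `D deg G ≤ D m`, so it is a scalar multiple of `f`
(`IsInvariantPair.pglComp_eq_self_iff`).

That the explicit pairs are invariant of degree `D` is checked on the reduced matrices, for which
`deg h < deg g = D` (`IsPolarPair`, `IsReducedPair.isPolarPair`), and is carried over by conjugation
(`IsPolarPair.isInvariantPair`). For the irreducible type the functions `(x + θ) ^ D` and
`(x + θ ^ q) ^ D` are eigenvectors of the action over the algebraic closure, with a common eigenvalue
(`isPolarPair_of_roots`).

For a suitable pair the transforms that are irreducible have degree exactly `D m`
(`IsInvariantPair.natDegree_eq_of_isTransform`). This can fail if infinity is a fixed point of `A`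
but not a pole of `Q`: for `Q = 1 / x ^ D` the polynomial `G = x ^ m` is transformed into `1`, and
multiples `x G₁` may have an irreducible transform of degree `D (m - 1)`. If `A` fixes infinity, the
conjugating matrix is therefore chosen to fix infinity as well
(`exists_isExplicitPair_of_eq_zero`). If `A` moves infinity, a transform of smaller degree is
divisible by `g - r h`, where `r = Q(∞)`, and this polynomial vanishes at the images of infinity,
which are rational points.
-/

/-! ### Binary forms -/

/-- The value at `(u, v)` of the binary form `∑ i ≤ n, aᵢ uⁱ vⁿ⁻ⁱ` of degree `n` attached to
`f = ∑ aᵢ xⁱ`, for `u`, `v` in an arbitrary commutative `F`-algebra. A point of the projective line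
is evaluated through homogeneous coordinates, so that no case distinction at infinity is needed;
`homogAt` is the case of the algebra `F[X]`. -/
noncomputable def binForm {F S : Type*} [Field F] [CommRing S] [Algebra F S] (n : ℕ) (f : F[X])
    (u v : S) : S :=
  ∑ i ∈ Finset.range (n + 1), algebraMap F S (f.coeff i) * u ^ i * v ^ (n - i)

section BinForm

variable {F S : Type*} [Field F] [CommRing S] [Algebra F S]

theorem homogAt_eq_binForm (n : ℕ) (f u v : F[X]) : homogAt n f u v = binForm n f u v := rfl

theorem binForm_eq_aeval_homogenize (n : ℕ) (f : F[X]) (u v : S) :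
    binForm n f u v = MvPolynomial.aeval ![u, v] (f.homogenize n) := by
  rw [binForm, homogenize, Finset.Nat.sum_antidiagonal_eq_sum_range_succ_mk, map_sum]
  refine Finset.sum_congr rfl fun i _ => ?_
  rw [Finsupp.update_eq_add_single (by simp), MvPolynomial.aeval_monomial,
    Finsupp.prod_add_index' (by simp) (by intros; rw [pow_add])]
  simp [mul_assoc]

theorem map_binForm {T : Type*} [CommRing T] [Algebra F T] (φ : S →ₐ[F] T) (n : ℕ) (f : F[X])
    (u v : S) : φ (binForm n f u v) = binForm n f (φ u) (φ v) := by
  simp [binForm, map_sum]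

theorem aeval_homogAt (n : ℕ) (f u v : F[X]) (z : S) :
    aeval z (homogAt n f u v) = binForm n f (aeval z u) (aeval z v) := by
  rw [homogAt_eq_binForm, map_binForm]

theorem binForm_one_right {n : ℕ} {f : F[X]} (hf : f.natDegree ≤ n) (z : S) :
    binForm n f z 1 = aeval z f := by
  rw [binForm_eq_aeval_homogenize, aeval_homogenize_of_eq_one hf _ (by simp)]
  simp

theorem binForm_X_one {n : ℕ} {f : F[X]} (hf : f.natDegree ≤ n) :
    binForm n f (X : F[X]) 1 = f := by
  rw [binForm_one_right hf, aeval_X_left_apply]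

theorem binForm_zero_right (n : ℕ) (f : F[X]) (u : S) :
    binForm n f u 0 = algebraMap F S (f.coeff n) * u ^ n := by
  rw [binForm, Finset.sum_range_succ, Finset.sum_eq_zero]
  · simp
  · intro i hi
    rw [zero_pow (by have := Finset.mem_range.1 hi; omega), mul_zero]

theorem binForm_one_zero (n : ℕ) (f : F[X]) : binForm n f (1 : F) 0 = f.coeff n := by
  simp [binForm_zero_right]

theorem binForm_mul_mul (n : ℕ) (f : F[X]) (s u v : S) :
    binForm n f (s * u) (s * v) = s ^ n * binForm n f u v := by
  rw [binForm, binForm, Finset.mul_sum]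
  refine Finset.sum_congr rfl fun i hi => ?_
  obtain ⟨k, rfl⟩ := Nat.exists_eq_add_of_le (Nat.lt_succ_iff.mp (Finset.mem_range.mp hi))
  rw [Nat.add_sub_cancel_left]
  ring

theorem binForm_C_mul (n : ℕ) (c : F) (f : F[X]) (u v : S) :
    binForm n (C c * f) u v = algebraMap F S c * binForm n f u v := by
  simp [binForm, Finset.mul_sum, mul_assoc]

theorem binForm_sub (n : ℕ) (f g : F[X]) (u v : S) :
    binForm n (f - g) u v = binForm n f u v - binForm n g u v := by
  simp [binForm, ← Finset.sum_sub_distrib, sub_mul]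

theorem binForm_mul {m n : ℕ} {f g : F[X]} (hf : f.natDegree ≤ m) (hg : g.natDegree ≤ n)
    (u v : S) : binForm (m + n) (f * g) u v = binForm m f u v * binForm n g u v := by
  simp only [binForm_eq_aeval_homogenize, homogenize_mul f g hf hg, map_mul]

theorem binForm_pow {n : ℕ} {f : F[X]} (hf : f.natDegree ≤ n) (k : ℕ) (u v : S) :
    binForm (n * k) (f ^ k) u v = binForm n f u v ^ k := by
  induction k with
  | zero => simp [binForm]
  | succ k ih =>
    rw [Nat.mul_succ, pow_succ, pow_succ,
      binForm_mul (natDegree_pow_le.trans (by rw [mul_comm]; gcongr)) hf, ih]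

/-- Substituting two forms of degree `D` into a form of degree `m` gives a form of degree `D m`. -/
theorem binForm_homogAt {D : ℕ} {g h : F[X]} (hg : g.natDegree ≤ D) (hh : h.natDegree ≤ D)
    (m : ℕ) (G : F[X]) (u v : S) :
    binForm (D * m) (homogAt m G g h) u v = binForm m G (binForm D g u v) (binForm D h u v) := by
  have hsum : ∀ s : Finset ℕ, ∀ p : ℕ → F[X],
      binForm (D * m) (∑ i ∈ s, p i) u v = ∑ i ∈ s, binForm (D * m) (p i) u v := by
    intro s p
    simp only [binForm_eq_aeval_homogenize, homogenize_finsetSum, map_sum]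
  rw [homogAt, hsum, binForm]
  refine Finset.sum_congr rfl fun i hi => ?_
  obtain ⟨k, rfl⟩ := Nat.exists_eq_add_of_le (Nat.lt_succ_iff.mp (Finset.mem_range.mp hi))
  rw [Nat.add_sub_cancel_left, mul_assoc, binForm_C_mul, Nat.mul_add,
    binForm_mul (natDegree_pow_le.trans (by rw [mul_comm]; gcongr))
      (natDegree_pow_le.trans (by rw [mul_comm]; gcongr)), binForm_pow hg, binForm_pow hh,
    mul_assoc]

theorem natDegree_homogAt_le {D : ℕ} {g h : F[X]} (hg : g.natDegree ≤ D) (hh : h.natDegree ≤ D)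
    (m : ℕ) (G : F[X]) : (homogAt m G g h).natDegree ≤ D * m := by
  refine natDegree_sum_le_of_forall_le _ _ fun i hi => ?_
  obtain ⟨k, rfl⟩ := Nat.exists_eq_add_of_le (Nat.lt_succ_iff.mp (Finset.mem_range.mp hi))
  rw [Nat.add_sub_cancel_left, mul_assoc]
  refine (natDegree_C_mul_le _ _).trans (natDegree_mul_le.trans ?_)
  rw [Nat.mul_add]
  refine Nat.add_le_add (natDegree_pow_le.trans ?_) (natDegree_pow_le.trans ?_)
  · rw [mul_comm]; gcongr
  · rw [mul_comm]; gcongr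

theorem coeff_homogAt {D : ℕ} {g h : F[X]} (hg : g.natDegree ≤ D) (hh : h.natDegree ≤ D)
    (m : ℕ) (G : F[X]) :
    (homogAt m G g h).coeff (D * m) = binForm m G (g.coeff D) (h.coeff D) := by
  rw [← binForm_one_zero, binForm_homogAt hg hh, binForm_one_zero, binForm_one_zero]

theorem dvd_binForm_sub (n : ℕ) (f : F[X]) (u v : S) :
    v ∣ binForm n f u v - algebraMap F S (f.coeff n) * u ^ n := by
  rw [binForm, Finset.sum_range_succ, Nat.sub_self, pow_zero, mul_one, add_sub_cancel_right]
  refine Finset.dvd_sum fun i hi => Dvd.dvd.mul_left (dvd_pow_self _ ?_) _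
  have := Finset.mem_range.1 hi
  omega

theorem binForm_eq_mul_pow {d n : ℕ} {f : F[X]} (hf : f.natDegree ≤ d) (hdn : d ≤ n) (u v : S) :
    binForm n f u v = binForm d f u v * v ^ (n - d) := by
  obtain ⟨k, rfl⟩ := Nat.exists_eq_add_of_le hdn
  have h1 : binForm k (1 : F[X]) u v = v ^ k := by simp [binForm_eq_aeval_homogenize]
  have h := binForm_mul hf (g := 1) (n := k) (by simp) u v
  rw [mul_one] at h
  rw [h, Nat.add_sub_cancel_left, h1]

theorem binForm_eq_pow_mul_aeval {L : Type*} [Field L] [Algebra F L] {n : ℕ} {f : F[X]}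
    (hf : f.natDegree ≤ n) (u : L) {v : L} (hv : v ≠ 0) :
    binForm n f u v = v ^ n * aeval (u / v) f := by
  rw [← binForm_one_right hf, ← binForm_mul_mul, mul_div_cancel₀ _ hv, mul_one]

end BinForm

/-! ### The substitution action, and invariant pairs of forms -/

section FormAct

variable {F S : Type*} [Field F] [CommRing S] [Algebra F S]

/-- The substitution action of `A = (a b; c d)` on forms of degree `n`:
`f ↦ (bx + d)ⁿ f((ax + c) / (bx + d))`. The degree `n` is fixed beforehand, and not read off from
`f` as in `glComp`, so that the action is linear and invertible. -/
noncomputable def formAct (n : ℕ) (A : GL (Fin 2) F) (f : F[X]) : F[X] :=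
  homogAt n f (topForm A) (botForm A)

theorem natDegree_topForm_le (A : GL (Fin 2) F) : (topForm A).natDegree ≤ 1 :=
  natDegree_linear_le

theorem natDegree_botForm_le (A : GL (Fin 2) F) : (botForm A).natDegree ≤ 1 :=
  natDegree_linear_le

theorem binForm_topForm (A : GL (Fin 2) F) (u v : S) :
    binForm 1 (topForm A) u v = algebraMap F S (A.1 0 0) * u + algebraMap F S (A.1 1 0) * v := by
  simp [binForm, topForm, Finset.sum_range_succ, coeff_X, coeff_C, add_comm]

theorem binForm_botForm (A : GL (Fin 2) F) (u v : S) :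
    binForm 1 (botForm A) u v = algebraMap F S (A.1 0 1) * u + algebraMap F S (A.1 1 1) * v := by
  simp [binForm, botForm, Finset.sum_range_succ, coeff_X, coeff_C, add_comm]

theorem natDegree_formAct_le (n : ℕ) (A : GL (Fin 2) F) (f : F[X]) :
    (formAct n A f).natDegree ≤ n := by
  simpa [formAct] using natDegree_homogAt_le (natDegree_topForm_le A) (natDegree_botForm_le A) n f

theorem binForm_formAct (n : ℕ) (A : GL (Fin 2) F) (f : F[X]) (u v : S) :
    binForm n (formAct n A f) u v =
      binForm n f (algebraMap F S (A.1 0 0) * u + algebraMap F S (A.1 1 0) * v)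
        (algebraMap F S (A.1 0 1) * u + algebraMap F S (A.1 1 1) * v) := by
  have h := binForm_homogAt (natDegree_topForm_le A) (natDegree_botForm_le A) n f u v
  rwa [one_mul, binForm_topForm, binForm_botForm] at h

theorem formAct_formAct (n : ℕ) (A B : GL (Fin 2) F) (f : F[X]) :
    formAct n A (formAct n B f) = formAct n (A * B) f := by
  conv_lhs => rw [formAct, homogAt_eq_binForm, binForm_formAct]
  rw [formAct, homogAt_eq_binForm]
  congr 1 <;> simp [topForm, botForm, Matrix.mul_apply, Fin.sum_univ_two] <;> ring

theorem formAct_one {n : ℕ} {f : F[X]} (hf : f.natDegree ≤ n) : formAct n 1 f = f := by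
  simp [formAct, topForm, botForm, homogAt_eq_binForm, binForm_X_one hf]

theorem formAct_of_smul {A B : GL (Fin 2) F} {s : F} (h : ∀ i j, B.1 i j = s * A.1 i j) (n : ℕ)
    (f : F[X]) : formAct n B f = C (s ^ n) * formAct n A f := by
  have ht : topForm B = C s * topForm A := by simp only [topForm, h, C_mul]; ring
  have hb : botForm B = C s * botForm A := by simp only [botForm, h, C_mul]; ring
  rw [formAct, formAct, ht, hb, homogAt_eq_binForm, binForm_mul_mul, C_pow, homogAt_eq_binForm]

theorem formAct_C_mul (n : ℕ) (A : GL (Fin 2) F) (c : F) (f : F[X]) :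
    formAct n A (C c * f) = C c * formAct n A f := by
  simp only [formAct, homogAt_eq_binForm, binForm_C_mul, algebraMap_eq]

theorem formAct_ne_zero {n : ℕ} (A : GL (Fin 2) F) {f : F[X]} (hf : f.natDegree ≤ n)
    (h0 : f ≠ 0) : formAct n A f ≠ 0 := by
  intro h
  have h1 := formAct_formAct n A⁻¹ A f
  rw [h, inv_mul_cancel, formAct_one hf] at h1
  exact h0 (by rw [← h1]; simp [formAct, homogAt])

/-- Substitution into a composite form acts on the two inner forms. -/
theorem formAct_homogAt {D : ℕ} {g h : F[X]} (hg : g.natDegree ≤ D) (hh : h.natDegree ≤ D)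
    (A : GL (Fin 2) F) (m : ℕ) (G : F[X]) :
    formAct (D * m) A (homogAt m G g h) = homogAt m G (formAct D A g) (formAct D A h) := by
  rw [formAct, homogAt_eq_binForm, binForm_homogAt hg hh]
  rfl

theorem pglMk_eq_pglMk {A B : GL (Fin 2) F} :
    pglMk A = pglMk B ↔ ∃ s : F, s ≠ 0 ∧ ∀ i j, B.1 i j = s * A.1 i j := by
  rw [pglMk, pglMk, QuotientGroup.eq, Matrix.GeneralLinearGroup.center_eq_range_scalar]
  constructor
  · rintro ⟨c, hc⟩
    refine ⟨c, c.ne_zero, fun i j => ?_⟩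
    have hBA : B = A * Matrix.GeneralLinearGroup.scalar (Fin 2) c := by rw [hc]; group
    rw [hBA, mul_comm]
    change (A.1 * Matrix.scalar (Fin 2) (c : F)) i j = _
    simp [Matrix.scalar_apply, Matrix.mul_diagonal]
  · rintro ⟨s, hs, h⟩
    refine ⟨Units.mk0 s hs, ?_⟩
    rw [eq_inv_mul_iff_mul_eq]
    ext i j
    rw [h, mul_comm s]
    change (A.1 * Matrix.scalar (Fin 2) s) i j = _
    simp [Matrix.scalar_apply, Matrix.mul_diagonal]

theorem pglMk_one : pglMk (1 : GL (Fin 2) F) = 1 := rfl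

theorem pglMk_mul (A B : GL (Fin 2) F) : pglMk (A * B) = pglMk A * pglMk B := rfl

theorem pglMk_pow (A : GL (Fin 2) F) (n : ℕ) : pglMk (A ^ n) = pglMk A ^ n := rfl

theorem pglMk_eq_one {A : GL (Fin 2) F} :
    pglMk A = 1 ↔ A.1 0 1 = 0 ∧ A.1 1 0 = 0 ∧ A.1 0 0 = A.1 1 1 := by
  rw [← pglMk_one, eq_comm, pglMk_eq_pglMk]
  constructor
  · rintro ⟨s, _, h⟩
    simp [h]
  · rintro ⟨h1, h2, h3⟩
    have hdet : A.1.det ≠ 0 := (Matrix.isUnits_det_units A).ne_zero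
    rw [Matrix.det_fin_two, h1, zero_mul, sub_zero] at hdet
    refine ⟨A.1 0 0, left_ne_zero_of_mul hdet, ?_⟩
    simp [Fin.forall_fin_two, h1, h2, ← h3]

theorem det_ne_zero_fin_two (A : GL (Fin 2) F) :
    A.1 0 0 * A.1 1 1 - A.1 0 1 * A.1 1 0 ≠ 0 := by
  rw [← Matrix.det_fin_two]
  exact (Matrix.isUnits_det_units A).ne_zero

theorem botForm_ne_zero (A : GL (Fin 2) F) : botForm A ≠ 0 := by
  intro h
  have h0 := congrArg (coeff · 0) h
  have h1 := congrArg (coeff · 1) h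
  simp [botForm, coeff_C] at h0 h1
  exact det_ne_zero_fin_two A (by rw [h0, h1]; ring)

/-- An invertible matrix maps a nonzero row vector to a nonzero row vector. -/
theorem row_mul_ne_zero {L : Type*} [Field L] [Algebra F L] (A : GL (Fin 2) F) {u v : L}
    (huv : u ≠ 0 ∨ v ≠ 0) :
    algebraMap F L (A.1 0 0) * u + algebraMap F L (A.1 1 0) * v ≠ 0 ∨
      algebraMap F L (A.1 0 1) * u + algebraMap F L (A.1 1 1) * v ≠ 0 := by
  by_contra! h
  have hd : algebraMap F L (A.1 0 0) * algebraMap F L (A.1 1 1) -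
      algebraMap F L (A.1 0 1) * algebraMap F L (A.1 1 0) ≠ 0 := by
    rw [← map_mul, ← map_mul, ← map_sub]
    exact (_root_.map_ne_zero _).2 (det_ne_zero_fin_two A)
  have hu : u = 0 := by
    refine (mul_eq_zero.1 ?_).resolve_left hd
    linear_combination algebraMap F L (A.1 1 1) * h.1 - algebraMap F L (A.1 1 0) * h.2
  have hv : v = 0 := by
    refine (mul_eq_zero.1 ?_).resolve_left hd
    linear_combination algebraMap F L (A.1 0 0) * h.2 - algebraMap F L (A.1 0 1) * h.1
  simp [hu, hv] at huv

end FormAct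

/-- `g / h` is a rational function of degree `D` that is invariant under `A`, written in lowest
terms as a quotient of two forms of degree `D`. The last field says that no irreducible polynomial
of large degree meets the poles of `g / h`. -/
structure IsInvariantPair {F : Type*} [Field F] (A : GL (Fin 2) F) (D : ℕ) (g h : F[X]) :
    Prop where
  isCoprime : IsCoprime g h
  natDegree_left : g.natDegree ≤ D
  natDegree_right : h.natDegree ≤ D
  coeff_ne_zero : g.coeff D ≠ 0 ∨ h.coeff D ≠ 0
  formAct_eq : ∃ c : F, c ≠ 0 ∧ formAct D A g = C c * g ∧ formAct D A h = C c * h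
  not_dvd : ∀ f : F[X], Irreducible f → D ≤ f.natDegree → 1 < f.natDegree → ¬ f ∣ h

/-- The special case of an invariant pair with `deg h < deg g = D`, that is, with a pole at
infinity. -/
structure IsPolarPair {F : Type*} [Field F] (R : GL (Fin 2) F) (D : ℕ) (g h : F[X]) :
    Prop where
  isCoprime : IsCoprime g h
  natDegree_left : g.natDegree = D
  natDegree_right : h.natDegree < D
  formAct_eq : ∃ c : F, c ≠ 0 ∧ formAct D R g = C c * g ∧ formAct D R h = C c * h

section Transport

variable {F : Type*} [Field F] {R : GL (Fin 2) F} {D : ℕ} {g h : F[X]}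

/-- The two forms of a polar pair have no common zero on the projective line. -/
theorem IsPolarPair.binForm_ne_zero (H : IsPolarPair R D g h) {L : Type*} [Field L] [Algebra F L]
    {u v : L} (huv : u ≠ 0 ∨ v ≠ 0) : binForm D g u v ≠ 0 ∨ binForm D h u v ≠ 0 := by
  by_cases hv : v = 0
  · subst hv
    left
    have hg : g.coeff D ≠ 0 := by
      rw [← H.natDegree_left, coeff_natDegree, leadingCoeff_ne_zero]
      rintro rfl
      have := H.natDegree_right
      simp [← H.natDegree_left] at this
    rw [binForm_zero_right]
    exact mul_ne_zero (by simpa using hg) (pow_ne_zero _ (by simpa using huv))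
  · rw [binForm_eq_pow_mul_aeval H.natDegree_left.le _ hv,
      binForm_eq_pow_mul_aeval H.natDegree_right.le _ hv]
    by_contra! hc
    have h1 := (mul_eq_zero.1 hc.1).resolve_left (pow_ne_zero _ hv)
    have h2 := (mul_eq_zero.1 hc.2).resolve_left (pow_ne_zero _ hv)
    obtain ⟨a, b, hab⟩ := H.isCoprime
    have := congrArg (aeval (u / v)) hab
    simp [h1, h2] at this

/-- A polar pair for `R` is carried by `P` to an invariant pair for every `A` with
`[A] = [P] [R] [P]⁻¹`. -/
theorem IsPolarPair.isInvariantPair (H : IsPolarPair R D g h) {A P : GL (Fin 2) F}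
    (hA : pglMk A = pglMk P * pglMk R * (pglMk P)⁻¹) :
    IsInvariantPair A D (formAct D P g) (formAct D P h) := by
  have hne : ∀ {L : Type _} [Field L] [Algebra F L] {u v : L}, (u ≠ 0 ∨ v ≠ 0) →
      binForm D (formAct D P g) u v ≠ 0 ∨ binForm D (formAct D P h) u v ≠ 0 := by
    intro L _ _ u v huv
    rw [binForm_formAct, binForm_formAct]
    exact H.binForm_ne_zero (row_mul_ne_zero P huv)
  refine ⟨?_, natDegree_formAct_le _ _ _, natDegree_formAct_le _ _ _, ?_, ?_, ?_⟩
  · rw [isCoprime_iff_aeval_ne_zero_of_isAlgClosed F (AlgebraicClosure F)]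
    intro z
    have := hne (u := z) (v := 1) (Or.inr one_ne_zero)
    rwa [binForm_one_right (natDegree_formAct_le _ _ _),
      binForm_one_right (natDegree_formAct_le _ _ _)] at this
  · have := hne (L := F) (u := 1) (v := 0) (Or.inl one_ne_zero)
    rwa [binForm_one_zero, binForm_one_zero] at this
  · obtain ⟨c, hc, hcg, hch⟩ := H.formAct_eq
    rw [eq_mul_inv_iff_mul_eq, ← pglMk_mul, ← pglMk_mul, eq_comm, pglMk_eq_pglMk] at hA
    obtain ⟨s, hs, hA⟩ := hA
    refine ⟨s ^ D * c, mul_ne_zero (pow_ne_zero _ hs) hc, ?_, ?_⟩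
    · rw [formAct_formAct, formAct_of_smul hA, ← formAct_formAct, hcg, formAct_C_mul, C_mul,
        mul_assoc]
    · rw [formAct_formAct, formAct_of_smul hA, ← formAct_formAct, hch, formAct_C_mul, C_mul,
        mul_assoc]
  · intro f hf hDf hf1 hdvd
    have h0 : h ≠ 0 := by
      rintro rfl
      have hu := (isCoprime_zero_right.1 H.isCoprime)
      have := natDegree_eq_zero_of_isUnit hu
      have := H.natDegree_right
      have := H.natDegree_left
      omega
    -- Seen as a form of its true degree `deg h < D`, `h` is carried to a polynomial of degree
    -- less than `D`; the remaining factor is a power of a linear form.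
    rw [formAct, homogAt_eq_binForm, binForm_eq_mul_pow le_rfl H.natDegree_right.le] at hdvd
    rcases hf.prime.dvd_or_dvd hdvd with h1 | h1
    · have h2 := natDegree_le_of_dvd h1 (formAct_ne_zero P le_rfl h0)
      have h3 := natDegree_formAct_le h.natDegree P h
      have h4 := H.natDegree_right
      rw [formAct, homogAt_eq_binForm] at h3
      omega
    · have h2 := natDegree_le_of_dvd (hf.prime.dvd_of_dvd_pow h1) (botForm_ne_zero P)
      have h3 := natDegree_botForm_le P
      omega

theorem IsInvariantPair.max_natDegree {A : GL (Fin 2) F} (H : IsInvariantPair A D g h) :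
    max g.natDegree h.natDegree = D := by
  refine le_antisymm (max_le H.natDegree_left H.natDegree_right) (le_max_iff.2 ?_)
  exact H.coeff_ne_zero.imp le_natDegree_of_ne_zero le_natDegree_of_ne_zero

end Transport

/-! ### Fractional linear maps on the roots of an invariant polynomial -/

section Moebius

variable {F L : Type*} [Field F] [Field L] [Algebra F L]

/-- The fractional linear map `z ↦ (az + c) / (bz + d)` attached to `A = (a b; c d)`. -/
noncomputable def moebius (A : GL (Fin 2) F) (z : L) : L :=
  (algebraMap F L (A.1 0 0) * z + algebraMap F L (A.1 1 0)) /
    (algebraMap F L (A.1 0 1) * z + algebraMap F L (A.1 1 1))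

theorem aeval_botForm (A : GL (Fin 2) F) (z : L) :
    aeval z (botForm A) = algebraMap F L (A.1 0 1) * z + algebraMap F L (A.1 1 1) := by
  simp [botForm]

theorem moebius_one (z : L) : moebius (1 : GL (Fin 2) F) z = z := by
  simp [moebius]

theorem moebius_moebius (A B : GL (Fin 2) F) {z : L} (hz : aeval z (botForm B) ≠ 0) :
    moebius A (moebius B z) = moebius (B * A) z := by
  rw [aeval_botForm] at hz
  rw [moebius, moebius, moebius]
  set v := algebraMap F L (B.1 0 1) * z + algebraMap F L (B.1 1 1) with hv
  rw [← mul_div_mul_left _ _ hz, mul_add, mul_add, mul_left_comm, mul_left_comm v,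
    mul_div_cancel₀ _ hz]
  congr 1 <;> simp [Matrix.mul_apply, Fin.sum_univ_two, hv] <;> ring

theorem aeval_formAct {n : ℕ} (A : GL (Fin 2) F) {f : F[X]} (hf : f.natDegree ≤ n) {z : L}
    (hz : aeval z (botForm A) ≠ 0) :
    aeval z (formAct n A f) = aeval z (botForm A) ^ n * aeval (moebius A z) f := by
  rw [aeval_botForm] at *
  rw [← binForm_one_right (natDegree_formAct_le n A f), binForm_formAct, mul_one, mul_one,
    binForm_eq_pow_mul_aeval hf _ hz, moebius]

/-- A root of an irreducible polynomial is not a root of a polynomial of smaller degree. -/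
theorem aeval_ne_zero_of_natDegree_lt {f : F[X]} (hf : Irreducible f) {z : L}
    (hz : aeval z f = 0) {p : F[X]} (hp : p ≠ 0) (hlt : p.natDegree < f.natDegree) :
    aeval z p ≠ 0 := by
  intro h
  have h1 : f ∣ p := by
    have := minpoly.dvd F z h
    rw [← minpoly.eq_of_irreducible hf hz] at this
    exact (dvd_mul_right _ _).trans this
  exact absurd (natDegree_le_of_dvd h1 hp) (by omega)

section Root

variable {f : F[X]} (hf : Irreducible f) (hdeg : 2 < f.natDegree)

include hf hdeg

theorem aeval_botForm_ne_zero {z : L} (hz : aeval z f = 0) (A : GL (Fin 2) F) :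
    aeval z (botForm A) ≠ 0 :=
  aeval_ne_zero_of_natDegree_lt hf hz (botForm_ne_zero A)
    ((natDegree_botForm_le A).trans_lt (by omega))

/-- A fixed point of a fractional linear map is a root of a polynomial of degree at most two. -/
theorem pglMk_eq_one_of_moebius_eq {z : L} (hz : aeval z f = 0) {A : GL (Fin 2) F}
    (h : moebius A z = z) : pglMk A = 1 := by
  have hb := aeval_botForm_ne_zero hf hdeg hz A
  rw [aeval_botForm] at hb
  rw [moebius, div_eq_iff hb] at h
  set p : F[X] := C (A.1 0 1) * X ^ 2 + C (A.1 1 1 - A.1 0 0) * X + C (-A.1 1 0) with hp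
  have hpz : aeval z p = 0 := by
    simp only [hp, map_add, map_mul, map_pow, aeval_X, aeval_C, map_sub, map_neg]
    linear_combination -h
  have hp0 : p = 0 := by
    by_contra hp0
    exact aeval_ne_zero_of_natDegree_lt hf hz hp0 (natDegree_quadratic_le.trans_lt hdeg) hpz
  have h0 := congrArg (coeff · 0) hp0
  have h1 := congrArg (coeff · 1) hp0
  have h2 := congrArg (coeff · 2) hp0
  simp [hp, coeff_X, coeff_C] at h0 h1 h2
  exact pglMk_eq_one.2 ⟨h2, h0, (sub_eq_zero.1 h1).symm⟩

theorem aeval_moebius_eq_zero {z : L} (hz : aeval z f = 0) {A : GL (Fin 2) F} {c : F}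
    (hc : formAct f.natDegree A f = C c * f) : aeval (moebius A z) f = 0 := by
  have hb := aeval_botForm_ne_zero hf hdeg hz A
  have h := aeval_formAct A le_rfl hb (f := f)
  rw [hc, map_mul, hz, mul_zero] at h
  exact (mul_eq_zero.1 h.symm).resolve_left (pow_ne_zero _ hb)

theorem moebius_pow_succ {z : L} (hz : aeval z f = 0) (A : GL (Fin 2) F) (i : ℕ) :
    moebius (A ^ (i + 1)) z = moebius A (moebius (A ^ i) z) := by
  rw [moebius_moebius _ _ (aeval_botForm_ne_zero hf hdeg hz _), pow_succ]

theorem aeval_moebius_pow_eq_zero {z : L} (hz : aeval z f = 0) {A : GL (Fin 2) F} {c : F}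
    (hc : formAct f.natDegree A f = C c * f) (i : ℕ) : aeval (moebius (A ^ i) z) f = 0 := by
  induction i with
  | zero => rwa [pow_zero, moebius_one]
  | succ i ih =>
    rw [moebius_pow_succ hf hdeg hz]
    exact aeval_moebius_eq_zero hf hdeg ih hc

/-- The orbit of a root of an invariant polynomial of degree at least three is as large as the
order of the class of the matrix allows. -/
theorem moebius_pow_injOn {z : L} (hz : aeval z f = 0) {A : GL (Fin 2) F} {c : F}
    (hc : formAct f.natDegree A f = C c * f) :
    Set.InjOn (fun i => moebius (A ^ i) z) (Finset.range (orderOf (pglMk A))) := by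
  have key : ∀ i j : ℕ, i < j → j < orderOf (pglMk A) →
      moebius (A ^ i) z ≠ moebius (A ^ j) z := by
    intro i j hij hj h
    have h1 : moebius (A ^ (j - i)) (moebius (A ^ i) z) = moebius (A ^ i) z := by
      rw [moebius_moebius _ _ (aeval_botForm_ne_zero hf hdeg hz _), ← pow_add,
        Nat.add_sub_cancel' hij.le, h]
    have h2 := pglMk_eq_one_of_moebius_eq hf hdeg (aeval_moebius_pow_eq_zero hf hdeg hz hc i) h1
    rw [pglMk_pow] at h2
    have := Nat.le_of_dvd (by omega) (orderOf_dvd_of_pow_eq_one h2)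
    omega
  intro i hi j hj h
  simp only [Finset.coe_range, Set.mem_Iio] at hi hj
  rcases lt_trichotomy i j with h1 | h1 | h1
  · exact absurd h (key i j h1 hj)
  · exact h1
  · exact absurd h.symm (key j i h1 hi)

end Root

end Moebius

/-! ### Invariance of irreducible polynomials and the transform -/

section Invariance

variable {F : Type*} [Field F] {A : GL (Fin 2) F} {D : ℕ} {g h f : F[X]}

theorem IsInvariantPair.aeval_moebius_div (H : IsInvariantPair A D g h) {L : Type*} [Field L]
    [Algebra F L] {z : L} (hz : aeval z (botForm A) ≠ 0) :
    aeval (moebius A z) g / aeval (moebius A z) h = aeval z g / aeval z h := by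
  obtain ⟨c, hc, hg, hh⟩ := H.formAct_eq
  have hg' := aeval_formAct A H.natDegree_left hz
  have hh' := aeval_formAct A H.natDegree_right hz
  rw [hg, map_mul, aeval_C] at hg'
  rw [hh, map_mul, aeval_C] at hh'
  have hc' : algebraMap F L c ≠ 0 := by simpa using hc
  rw [← mul_div_mul_left _ _ (pow_ne_zero D hz), ← hg', ← hh', mul_div_mul_left _ _ hc']

/-- A nonconstant rational function is transcendental: no nonzero polynomial vanishes at `g / h`.
Indeed `h` would be a constant by coprimality, and then the leading term of `G(g / h)` survives. -/
theorem IsInvariantPair.homogAt_ne_zero (H : IsInvariantPair A D g h) (hD : 0 < D) {G : F[X]}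
    (hG : G ≠ 0) : homogAt G.natDegree G g h ≠ 0 := by
  intro h0
  have hlc : G.coeff G.natDegree ≠ 0 := by simpa using hG
  have hdvd := dvd_binForm_sub G.natDegree G g h
  rw [← homogAt_eq_binForm, h0, zero_sub, dvd_neg, algebraMap_eq] at hdvd
  have hu : IsUnit h := by
    refine IsCoprime.isUnit_of_dvd' (H.isCoprime.symm.pow_right (n := G.natDegree)) dvd_rfl ?_
    exact ((isUnit_C.2 hlc.isUnit).dvd_mul_left).1 hdvd
  have hh : h.coeff D = 0 :=
    coeff_eq_zero_of_natDegree_lt (by rwa [natDegree_eq_zero_of_isUnit hu])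
  have hg := H.coeff_ne_zero.resolve_right (not_not.2 hh)
  have h1 := coeff_homogAt H.natDegree_left H.natDegree_right G.natDegree G
  rw [h0, hh, binForm_zero_right, coeff_zero, eq_comm] at h1
  exact mul_ne_zero (by simpa using hlc) (pow_ne_zero _ hg) h1

theorem pglComp_eq_self_of_formAct {c : F} (hf : f.Monic) (hc : c ≠ 0)
    (h : formAct f.natDegree A f = C c * f) : pglComp (pglMk A) f = f := by
  change monicPart (formAct f.natDegree A f) = f
  rw [h, monicPart, leadingCoeff_mul, leadingCoeff_C, hf.leadingCoeff, mul_one, ← mul_assoc,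
    ← C_mul, inv_mul_cancel₀ hc, C_1, one_mul]

theorem formAct_of_pglComp_eq_self (hf : f ≠ 0) (h : pglComp (pglMk A) f = f) :
    ∃ c : F, formAct f.natDegree A f = C c * f := by
  change C (formAct f.natDegree A f).leadingCoeff⁻¹ * formAct f.natDegree A f = f at h
  set k := formAct f.natDegree A f with hk
  have hk0 : k ≠ 0 := formAct_ne_zero A le_rfl hf
  refine ⟨k.leadingCoeff, ?_⟩
  conv_rhs => rw [← h, ← mul_assoc, ← C_mul, mul_inv_cancel₀ (leadingCoeff_ne_zero.2 hk0)]
  rw [C_1, one_mul]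

/-- If `α` is a root of an invariant polynomial `f` then every conjugate of `g(α) / h(α)` has at
least `D` preimages among the roots of `f`, namely an orbit of the fractional linear map. -/
theorem IsInvariantPair.mul_natDegree_minpoly_le [PerfectField F] (H : IsInvariantPair A D g h)
    (hD : D = orderOf (pglMk A)) (hf : Irreducible f) (hdeg : 2 < f.natDegree) {c : F}
    (hc : formAct f.natDegree A f = C c * f) {K : Type*} [Field K] [Algebra F K]
    [IsAlgClosure F K] {α : K} (hα : aeval α f = 0) :
    D * (minpoly F (aeval α g / aeval α h)).natDegree ≤ f.natDegree := by
  classical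
  have : IsAlgClosed K := IsAlgClosure.isAlgClosed F
  have : Normal F K := IsAlgClosure.normal F K
  set Q : K → K := fun z => aeval z g / aeval z h with hQ
  have hint : IsIntegral F (Q α) := Algebra.IsIntegral.isIntegral _
  have hT : (minpoly F (Q α)).natDegree = ((minpoly F (Q α)).rootSet K).ncard := by
    rw [← Nat.card_coe_set_eq, Nat.card_eq_fintype_card, card_rootSet_eq_natDegree
      (PerfectField.separable_of_irreducible (minpoly.irreducible hint))
      (IsAlgClosed.splits _)]
  have hS : (f.aroots K).toFinset.card ≤ f.natDegree := by
    refine (Multiset.toFinset_card_le _).trans ((card_roots' _).trans ?_)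
    exact natDegree_map_le
  refine le_trans ?_ hS
  rw [hT, rootSet_def, Set.ncard_coe_finset]
  refine le_trans ?_ (Finset.card_filter_le _ (fun z => Q z ∈ (minpoly F (Q α)).aroots K))
  refine Finset.mul_card_image_le_card_of_maps_to (f := Q)
    (by simp only [Finset.mem_filter, Multiset.mem_toFinset]; exact fun z hz => hz.2) D ?_
  intro t ht
  -- every conjugate of `g(α) / h(α)` is the value at a conjugate of `α`
  obtain ⟨z, hz, rfl⟩ : ∃ z : K, aeval z f = 0 ∧ Q z = t := by
    rw [Multiset.mem_toFinset, mem_aroots] at ht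
    obtain ⟨σ, hσ⟩ := (isConjRoot_iff_exists_algEquiv (K := F)).1
      (isConjRoot_of_aeval_eq_zero hint ht.2)
    have hσ' : σ.symm (Q α) = t := by rw [← hσ, AlgEquiv.symm_apply_apply]
    refine ⟨σ.symm α, ?_, ?_⟩
    · rw [aeval_algHom_apply, hα, map_zero]
    · rw [← hσ']
      simp only [hQ]
      rw [aeval_algHom_apply, aeval_algHom_apply, map_div₀]
  have himg : ((Finset.range D).image fun i => moebius (A ^ i) z).card = D := by
    rw [Finset.card_image_of_injOn (hD ▸ moebius_pow_injOn hf hdeg hz hc), Finset.card_range]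
  refine himg.ge.trans (Finset.card_le_card ?_)
  have hroot := aeval_moebius_pow_eq_zero hf hdeg hz hc
  have hQi : ∀ i, Q (moebius (A ^ i) z) = Q z := by
    intro i
    induction i with
    | zero => rw [pow_zero, moebius_one]
    | succ i ih =>
      rw [moebius_pow_succ hf hdeg hz, ← ih]
      exact H.aeval_moebius_div (aeval_botForm_ne_zero hf hdeg (hroot i) A)
  intro w hw
  obtain ⟨i, -, rfl⟩ := Finset.mem_image.1 hw
  rw [Multiset.mem_toFinset] at ht
  simp only [Finset.mem_filter, Multiset.mem_toFinset, mem_aroots]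
  refine ⟨⟨⟨hf.ne_zero, hroot i⟩, ?_⟩, hQi i⟩
  rw [hQi]
  exact mem_aroots.1 ht

/-- An irreducible polynomial `f` of degree `D m > 2` is `[A]`-invariant if and only if it is
a transform by the invariant rational function `g / h` of degree `D`. For the direct implication
the polynomial transformed is, up to a scalar, the minimal polynomial of `g(α) / h(α)`, for a root
`α` of `f`. -/
theorem IsInvariantPair.pglComp_eq_self_iff [PerfectField F] (H : IsInvariantPair A D g h)
    (hD : D = orderOf (pglMk A)) {m : ℕ} (hm : 2 < D * m) (hmon : f.Monic) (hf : Irreducible f)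
    (hdeg : f.natDegree = D * m) : pglComp (pglMk A) f = f ↔ IsTransform g h m f := by
  have hD0 : 0 < D := Nat.pos_of_ne_zero (by rintro rfl; simp at hm)
  have hm0 : 0 < m := Nat.pos_of_ne_zero (by rintro rfl; simp at hm)
  constructor
  · intro hinv
    obtain ⟨c, hc⟩ := formAct_of_pglComp_eq_self hmon.ne_zero hinv
    obtain ⟨α, hα⟩ := IsAlgClosed.exists_aeval_eq_zero (AlgebraicClosure F) f
      (degree_pos_of_irreducible hf).ne'
    have hint : IsIntegral F (aeval α g / aeval α h) := Algebra.IsIntegral.isIntegral _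
    have hle := H.mul_natDegree_minpoly_le hD hf (hdeg ▸ hm) hc hα
    set G := minpoly F (aeval α g / aeval α h) with hG
    have hG0 : G ≠ 0 := minpoly.ne_zero hint
    have hhα : aeval α h ≠ 0 := by
      intro h0
      have h1 := minpoly.dvd F α h0
      rw [← minpoly.eq_of_irreducible_of_monic hf hα hmon] at h1
      exact H.not_dvd f hf (hdeg ▸ Nat.le_mul_of_pos_right D hm0) (by omega) h1
    have hroot : aeval α (homogAt G.natDegree G g h) = 0 := by
      rw [aeval_homogAt, binForm_eq_pow_mul_aeval le_rfl _ hhα, minpoly.aeval, mul_zero]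
    obtain ⟨k, hk⟩ : f ∣ homogAt G.natDegree G g h := by
      have h1 := minpoly.dvd F α hroot
      rwa [← minpoly.eq_of_irreducible_of_monic hf hα hmon] at h1
    have hne := H.homogAt_ne_zero hD0 hG0
    have hle' := natDegree_homogAt_le H.natDegree_left H.natDegree_right G.natDegree G
    have hk0 : k ≠ 0 := by
      rintro rfl
      exact hne (by rw [hk, mul_zero])
    rw [hk, natDegree_mul hf.ne_zero hk0, hdeg] at hle'
    rw [hdeg] at hle
    have hGm : G.natDegree = m :=
      le_antisymm (Nat.le_of_mul_le_mul_left hle hD0)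
        (Nat.le_of_mul_le_mul_left (by omega) hD0)
    obtain ⟨a, rfl⟩ : ∃ a, k = C a := ⟨_, eq_C_of_natDegree_eq_zero (by rw [hGm] at hle'; omega)⟩
    have ha : a ≠ 0 := by simpa using hk0
    refine ⟨C a⁻¹ * G, by rw [natDegree_C_mul (inv_ne_zero ha), hGm], ?_⟩
    rw [homogAt_eq_binForm, binForm_C_mul, ← homogAt_eq_binForm, ← hGm, hk, algebraMap_eq,
      mul_left_comm, ← C_mul, inv_mul_cancel₀ ha, C_1, mul_one]
  · rintro ⟨G, -, hG⟩
    obtain ⟨c, hc, hcg, hch⟩ := H.formAct_eq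
    refine pglComp_eq_self_of_formAct hmon (pow_ne_zero m hc) ?_
    rw [hdeg, hG, formAct_homogAt H.natDegree_left H.natDegree_right, hcg, hch,
      homogAt_eq_binForm, binForm_mul_mul, C_pow, homogAt_eq_binForm]

end Invariance

/-! ### Reduced matrices with a fixed point at infinity, and antidiagonal matrices -/

section Reduced

variable {F : Type*} [Field F] {D : ℕ} {R : GL (Fin 2) F} {g h : F[X]}

theorem isPolarPair_one : IsPolarPair (1 : GL (Fin 2) F) 1 X 1 where
  isCoprime := isCoprime_one_right
  natDegree_left := natDegree_X
  natDegree_right := by simp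
  formAct_eq := ⟨1, one_ne_zero, by rw [formAct_one natDegree_X_le]; simp,
    by rw [formAct_one (by simp)]; simp⟩

/-- The action on forms when the bottom form is `1`: substitution of the top form. -/
theorem formAct_of_botForm_eq_one {n : ℕ} {f : F[X]} (hf : f.natDegree ≤ n)
    (hR : botForm R = 1) : formAct n R f = f.comp (topForm R) := by
  rw [formAct, hR, homogAt_eq_binForm, binForm_one_right hf, comp_eq_aeval]

theorem isPolarPair_diagonal {a : F} (hD0 : 0 < D) (hD : pglMk R ^ D = 1)
    (hR : R.1 = !![a, 0; 0, 1]) : IsPolarPair R D (X ^ D) 1 := by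
  have hbot : botForm R = 1 := by simp [botForm, hR]
  have htop : topForm R = C a * X := by simp [topForm, hR]
  have hpow : ∀ n : ℕ, (R ^ n).1 = !![a ^ n, 0; 0, 1] := by
    intro n
    induction n with
    | zero => simp [Matrix.one_fin_two]
    | succ n ih =>
      rw [pow_succ, Units.val_mul, ih, hR]
      simp [pow_succ]
  rw [← pglMk_pow, pglMk_eq_one, hpow] at hD
  refine ⟨isCoprime_one_right, natDegree_X_pow D, by simpa using hD0, 1, one_ne_zero, ?_, ?_⟩
  · rw [formAct_of_botForm_eq_one (natDegree_X_pow_le D) hbot, htop, X_pow_comp, mul_pow, ← C_pow,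
      show a ^ D = 1 by simpa using hD.2.2]
  · rw [formAct_of_botForm_eq_one (by simp) hbot]
    simp

theorem isPolarPair_unipotent [Finite F] (hR : R.1 = !![1, 0; 1, 1]) :
    orderOf (pglMk R) = ringChar F ∧
      IsPolarPair R (ringChar F) (X ^ ringChar F - X) 1 := by
  have hpow : ∀ n : ℕ, (R ^ n).1 = !![1, 0; (n : F), 1] := by
    intro n
    induction n with
    | zero => simp [Matrix.one_fin_two]
    | succ n ih =>
      rw [pow_succ, Units.val_mul, ih, hR]
      simp
  have hone : ∀ n : ℕ, pglMk R ^ n = 1 ↔ (n : F) = 0 := by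
    intro n
    rw [← pglMk_pow, pglMk_eq_one, hpow]
    simp
  have hbot : botForm R = 1 := by simp [botForm, hR]
  have htop : topForm R = X + 1 := by simp [topForm, hR]
  have hp : (ringChar F).Prime := CharP.char_is_prime F (ringChar F)
  have : Fact (ringChar F).Prime := ⟨hp⟩
  have hdeg : (X ^ ringChar F - X : F[X]).natDegree = ringChar F :=
    FiniteField.X_pow_card_sub_X_natDegree_eq F hp.one_lt
  refine ⟨Nat.dvd_antisymm (orderOf_dvd_of_pow_eq_one ((hone _).2 (by simp)))
    ((ringChar.spec F _).1 ((hone _).1 (pow_orderOf_eq_one _))),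
    isCoprime_one_right, hdeg, by simpa using hp.pos, 1, one_ne_zero, ?_, ?_⟩
  · rw [formAct_of_botForm_eq_one hdeg.le hbot, htop]
    simp only [sub_comp, X_pow_comp, X_comp, C_1, one_mul]
    rw [add_pow_char, one_pow]
    ring
  · rw [formAct_of_botForm_eq_one (by simp) hbot]
    simp

theorem isPolarPair_antidiagonal {b : F} (hb : ¬ IsSquare b) (hR : R.1 = !![0, 1; b, 0]) :
    orderOf (pglMk R) = 2 ∧ IsPolarPair R 2 (X ^ 2 + C b) X := by
  have hb0 : b ≠ 0 := by
    rintro rfl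
    exact hb IsSquare.zero
  have hbot : botForm R = X := by simp [botForm, hR]
  have htop : topForm R = C b := by simp [topForm, hR]
  refine ⟨orderOf_eq_prime ?_ ?_, ?_, natDegree_X_pow_add_C, by simp, b, hb0, ?_, ?_⟩
  · rw [← pglMk_pow, pglMk_eq_one, pow_two, Units.val_mul, hR]
    simp
  · rw [Ne, pglMk_eq_one, hR]
    simp
  · refine ⟨C b⁻¹, -(C b⁻¹ * X), ?_⟩
    have : C b⁻¹ * C b = (1 : F[X]) := by rw [← C_mul, inv_mul_cancel₀ hb0, C_1]
    linear_combination this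
  · rw [formAct, htop, hbot, homogAt]
    simp [Finset.sum_range_succ, coeff_X_pow, coeff_C]
    ring
  · rw [formAct, htop, hbot, homogAt]
    simp [coeff_X]

end Reduced

/-! ### Reduced matrices with irreducible characteristic polynomial -/

section Quadratic

variable {F : Type*} [Field F]

theorem map_homogAt {K : Type*} [Field K] (φ : F →+* K) (n : ℕ) (f u v : F[X]) :
    (homogAt n f u v).map φ = binForm n (f.map φ) (u.map φ) (v.map φ) := by
  simp [homogAt, binForm, Polynomial.map_sum]

theorem binForm_X_add_C_pow {S : Type*} [CommRing S] [Algebra F S] (n : ℕ) (r : F) (u v : S) :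
    binForm n ((X + C r) ^ n) u v = (u + algebraMap F S r * v) ^ n := by
  have h := binForm_pow (natDegree_X_add_C r).le n u v
  rw [one_mul] at h
  rw [h]
  simp [binForm, Finset.sum_range_succ, coeff_X, coeff_C, add_comm]

/-- An element of an extension fixed by the `q`-th power map lies in the field of `q` elements. -/
theorem mem_range_of_pow_card_eq [Finite F] {K : Type*} [Field K] [Algebra F K] {x : K}
    (hx : x ^ Nat.card F = x) : x ∈ Set.range (algebraMap F K) := by
  have := Fintype.ofFinite F
  rw [Nat.card_eq_fintype_card] at hx
  have hroots := FiniteField.roots_X_pow_card_sub_X F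
  have hdeg := FiniteField.X_pow_card_sub_X_natDegree_eq F (Fintype.one_lt_card (α := F))
  have hmap := roots_map_of_injective_of_card_eq_natDegree (algebraMap F K).injective
    (p := X ^ Fintype.card F - X) (by rw [hroots, hdeg]; rfl)
  have hmem : x ∈ ((X ^ Fintype.card F - X : F[X]).map (algebraMap F K)).roots := by
    rw [mem_roots (Polynomial.map_ne_zero
      (FiniteField.X_pow_card_sub_X_ne_zero F Fintype.one_lt_card))]
    simp [hx]
  rw [← hmap, hroots, Multiset.mem_map] at hmem
  obtain ⟨a, -, ha⟩ := hmem
  exact ⟨a, ha⟩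

theorem not_mem_range_of_irreducible {K : Type*} [Field K] [Algebra F K] {c : F} {θ : K}
    (hc : Irreducible (X ^ 2 - X - C c : F[X])) (hθ : θ ^ 2 - θ - algebraMap F K c = 0) :
    θ ∉ Set.range (algebraMap F K) := by
  rintro ⟨t, rfl⟩
  have hdeg : (X ^ 2 - X - C c : F[X]).natDegree = 2 := by compute_degree!
  have ht : (X ^ 2 - X - C c : F[X]).IsRoot t := by
    rw [← map_pow, ← map_sub, ← map_sub] at hθ
    simpa using (map_eq_zero _).1 hθ
  have h1 := degree_eq_one_of_irreducible_of_root hc ht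
  rw [degree_eq_natDegree hc.ne_zero, hdeg] at h1
  exact absurd h1 (by decide)

variable {K : Type*} [Field K] [Algebra F K] {D : ℕ} {R : GL (Fin 2) F} {g h : F[X]} {c : F}

/-- The column `(1, θ)` is an eigenvector of `(0 1; c 1)` with eigenvalue `θ`. -/
theorem pow_eq_of_root {θ : K} (hR : R.1 = !![0, 1; c, 1])
    (hθ : θ ^ 2 - θ - algebraMap F K c = 0) (n : ℕ) :
    algebraMap F K ((R ^ n).1 0 0) + algebraMap F K ((R ^ n).1 0 1) * θ = θ ^ n := by
  induction n with
  | zero => simp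
  | succ n ih =>
    rw [pow_succ θ, ← ih, pow_succ, Units.val_mul, hR]
    simp [Matrix.mul_apply, Fin.sum_univ_two]
    linear_combination - algebraMap F K ((R ^ n).1 0 1) * hθ

/-- With `u = (X + θ)ᴰ` and `u' = (X + θ')ᴰ` one has `g - θ h = u'` and `g - θ' h = u`. These two
powers are coprime, and they are eigenvectors of the substitution action of `R` for the eigenvalues
`θᴰ` and `θ'ᴰ`, which agree because `Rᴰ` is scalar. -/
theorem isPolarPair_of_roots {θ θ' : K} (hD0 : 0 < D) (hD : pglMk R ^ D = 1)
    (hR : R.1 = !![0, 1; c, 1]) (hθ : θ ^ 2 - θ - algebraMap F K c = 0)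
    (hθ' : θ' ^ 2 - θ' - algebraMap F K c = 0) (hne : θ' ≠ θ)
    (hg : g.map (algebraMap F K) =
      C (θ' - θ)⁻¹ * (C θ' * (X + C θ') ^ D - C θ * (X + C θ) ^ D))
    (hh : h.map (algebraMap F K) = C (θ' - θ)⁻¹ * ((X + C θ') ^ D - (X + C θ) ^ D)) :
    IsPolarPair R D g h := by
  have he : (θ' - θ)⁻¹ * (θ' - θ) = 1 := inv_mul_cancel₀ (sub_ne_zero.2 hne)
  have hCe : (C (θ' - θ)⁻¹ : K[X]) * (C θ' - C θ) = 1 := by rw [← C_sub, ← C_mul, he, C_1]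
  have hcoeff : ∀ r : K, ((X + C r) ^ D).coeff D = 1 := fun r => by simp [coeff_X_add_C_pow]
  have hdeg : ∀ r : K, ((X + C r) ^ D).natDegree ≤ D := fun r => by simp
  have hgdeg : g.natDegree ≤ D := by
    rw [← natDegree_map (algebraMap F K), hg]
    refine (natDegree_C_mul_le _ _).trans ((natDegree_sub_le _ _).trans (max_le ?_ ?_)) <;>
      exact (natDegree_C_mul_le _ _).trans (hdeg _)
  have hhdeg : h.natDegree ≤ D := by
    rw [← natDegree_map (algebraMap F K), hh]
    exact (natDegree_C_mul_le _ _).trans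
      ((natDegree_sub_le _ _).trans (max_le (hdeg _) (hdeg _)))
  have hgD : g.coeff D = 1 := by
    apply (algebraMap F K).injective
    rw [← coeff_map, hg, coeff_C_mul, coeff_sub, coeff_C_mul, coeff_C_mul, hcoeff, hcoeff, mul_one,
      mul_one, he, map_one]
  have hhD : h.coeff D = 0 := by
    apply (algebraMap F K).injective
    rw [← coeff_map, hh, coeff_C_mul, coeff_sub, hcoeff, hcoeff, sub_self, mul_zero, map_zero]
  refine ⟨?_, le_antisymm hgdeg (le_natDegree_of_ne_zero (by rw [hgD]; exact one_ne_zero)), ?_, ?_⟩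
  · have hcop : IsCoprime ((X + C θ' : K[X]) ^ D) ((X + C θ) ^ D) :=
      IsCoprime.pow ⟨C (θ' - θ)⁻¹, -C (θ' - θ)⁻¹, by linear_combination hCe⟩
    obtain ⟨a, b, hab⟩ := hcop
    rw [← isCoprime_map (algebraMap F K), hg, hh]
    refine ⟨a + b, -(a * C θ) - b * C θ', ?_⟩
    linear_combination hab + (a * (X + C θ') ^ D + b * (X + C θ) ^ D) * hCe
  · have := natDegree_le_pred hhdeg hhD
    omega
  · obtain ⟨h01, h10, h00⟩ := pglMk_eq_one.1 ((pglMk_pow R D).trans hD)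
    have hs := det_ne_zero_fin_two (R ^ D)
    rw [h01, zero_mul, sub_zero] at hs
    have hpow := pow_eq_of_root hR hθ D
    have hpow' := pow_eq_of_root hR hθ' D
    rw [h01, map_zero, zero_mul, add_zero] at hpow hpow'
    set s := (R ^ D).1 0 0
    have htop : (topForm R).map (algebraMap F K) = C (algebraMap F K c) := by simp [topForm, hR]
    have hbot : (botForm R).map (algebraMap F K) = X + 1 := by simp [botForm, hR]
    have hlin : ∀ t : K, t ^ 2 - t - algebraMap F K c = 0 →
        (C (algebraMap F K c) + algebraMap K K[X] t * (X + 1) : K[X]) = C t * (X + C t) := by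
      intro t ht
      have : C (algebraMap F K c) = (C t ^ 2 - C t : K[X]) := by
        rw [← C_pow, ← C_sub]
        exact congrArg C (by linear_combination -ht)
      rw [this, algebraMap_eq]
      ring
    refine ⟨s, left_ne_zero_of_mul hs, ?_, ?_⟩ <;>
      apply Polynomial.map_injective _ (algebraMap F K).injective
    · rw [formAct, map_homogAt, htop, hbot, Polynomial.map_mul, map_C, hg, binForm_C_mul,
        binForm_sub, binForm_C_mul, binForm_C_mul, binForm_X_add_C_pow, binForm_X_add_C_pow,
        hlin _ hθ, hlin _ hθ', mul_pow, mul_pow, ← C_pow, ← C_pow, ← hpow, ← hpow']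
      simp only [algebraMap_eq]
      ring
    · rw [formAct, map_homogAt, htop, hbot, Polynomial.map_mul, map_C, hh, binForm_C_mul,
        binForm_sub, binForm_X_add_C_pow, binForm_X_add_C_pow,
        hlin _ hθ, hlin _ hθ', mul_pow, mul_pow, ← C_pow, ← C_pow, ← hpow, ← hpow']
      simp only [algebraMap_eq]
      ring

/-- The polynomials of `isPolarPair_of_roots` have coefficients in `F`: writing
`(X + θ)ᴰ = u + θ v` with `u`, `v` over `F`, they are `u + v` and `v`. -/
theorem exists_map_eq_of_roots {θ θ' : K} (hθ : θ ^ 2 - θ - algebraMap F K c = 0)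
    (hθ' : θ' ^ 2 - θ' - algebraMap F K c = 0) (hne : θ' ≠ θ) (D : ℕ) :
    ∃ g h : F[X], g.map (algebraMap F K) =
        C (θ' - θ)⁻¹ * (C θ' * (X + C θ') ^ D - C θ * (X + C θ) ^ D) ∧
      h.map (algebraMap F K) = C (θ' - θ)⁻¹ * ((X + C θ') ^ D - (X + C θ) ^ D) := by
  obtain ⟨u, v, huv⟩ : ∃ u v : F[X], ∀ t : K, t ^ 2 - t - algebraMap F K c = 0 →
      (X + C t) ^ D = u.map (algebraMap F K) + C t * v.map (algebraMap F K) := by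
    induction D with
    | zero => exact ⟨1, 0, fun t _ => by simp⟩
    | succ n ih =>
      obtain ⟨u, v, huv⟩ := ih
      refine ⟨u * X + C c * v, u + v * X + v, fun t ht => ?_⟩
      have : (C t ^ 2 : K[X]) = C t + C (algebraMap F K c) := by
        rw [← C_pow, ← C_add]
        exact congrArg C (by linear_combination ht)
      rw [pow_succ, huv t ht]
      simp only [Polynomial.map_add, Polynomial.map_mul, map_X, map_C]
      linear_combination v.map (algebraMap F K) * this
  have hCe : (C (θ' - θ)⁻¹ : K[X]) * (C θ' - C θ) = 1 := by
    rw [← C_sub, ← C_mul, inv_mul_cancel₀ (sub_ne_zero.2 hne), C_1]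
  have hsum : (C θ + C θ' : K[X]) = 1 := by
    rw [← C_add, ← C_1]
    congr 1
    refine sub_eq_zero.1 ((mul_eq_zero.1 ?_).resolve_left (sub_ne_zero.2 hne))
    linear_combination hθ' - hθ
  refine ⟨u + v, v, ?_, ?_⟩
  · rw [huv θ hθ, huv θ' hθ', Polynomial.map_add]
    linear_combination (-(u.map (algebraMap F K)) - v.map (algebraMap F K)) * hCe -
      C (θ' - θ)⁻¹ * (C θ' - C θ) * v.map (algebraMap F K) * hsum
  · rw [huv θ hθ, huv θ' hθ']
    linear_combination (-(v.map (algebraMap F K))) * hCe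

theorem pow_card_isRoot [Finite F] {θ : K} (hθ : θ ^ 2 - θ - algebraMap F K c = 0) :
    (θ ^ Nat.card F) ^ 2 - θ ^ Nat.card F - algebraMap F K c = 0 := by
  have := Fintype.ofFinite F
  have h := congrArg (FiniteField.frobeniusAlgHom F K) hθ
  rw [map_sub, map_sub, map_pow, AlgHom.commutes, map_zero] at h
  simpa [Nat.card_eq_fintype_card] using h

end Quadratic

/-! ### Explicit pairs are invariant pairs -/

section Explicit

variable {F : Type*} [Field F]

theorem orderOf_eq_of_conj {A P R : GL (Fin 2) F}
    (hA : pglMk A = pglMk P * pglMk R * (pglMk P)⁻¹) :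
    orderOf (pglMk A) = orderOf (pglMk R) := by
  rw [hA, ← MulAut.conj_apply, MulEquiv.orderOf_eq]

variable [Finite F]

theorem orderOf_pglMk_pos (A : GL (Fin 2) F) : 0 < orderOf (pglMk A) := by
  have : Finite (PGL2 F) := Quotient.finite _
  exact orderOf_pos _

theorem IsReducedPair.isPolarPair {R : GL (Fin 2) F} {g h : F[X]} {t : PGLType}
    (H : IsReducedPair (orderOf (pglMk R)) R g h t) :
    IsPolarPair R (orderOf (pglMk R)) g h := by
  have hD0 := orderOf_pglMk_pos R
  have hD := pow_orderOf_eq_one (pglMk R)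
  cases t with
  | zero =>
    obtain ⟨rfl, rfl, rfl⟩ := H
    rw [pglMk_one, orderOf_one]
    exact isPolarPair_one
  | one =>
    obtain ⟨a, -, hR, rfl, rfl⟩ := H
    exact isPolarPair_diagonal hD0 hD hR
  | two =>
    obtain ⟨hR, rfl, rfl⟩ := H
    obtain ⟨h1, h2⟩ := isPolarPair_unipotent hR
    rwa [h1]
  | three =>
    obtain ⟨b, hb, hR, rfl, rfl⟩ := H
    obtain ⟨h1, h2⟩ := isPolarPair_antidiagonal hb hR
    rwa [h1]
  | four =>
    obtain ⟨c, hc, hR, θ, hθ, hg, hh⟩ := H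
    exact isPolarPair_of_roots hD0 hD hR hθ (pow_card_isRoot hθ)
      (fun h => not_mem_range_of_irreducible hc hθ (mem_range_of_pow_card_eq h)) hg hh

theorem IsExplicitPair.isInvariantPair {A : GL (Fin 2) F} {g h : F[X]} {t : PGLType}
    (H : IsExplicitPair t A g h) : IsInvariantPair A (orderOf (pglMk A)) g h := by
  obtain ⟨R, P, g₀, h₀, hA, hR, rfl, rfl⟩ := H
  have hord := orderOf_eq_of_conj hA
  rw [hord] at hR ⊢
  exact hR.isPolarPair.isInvariantPair hA

end Explicit

/-! ### The degree of a transform -/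

section Degree

variable {F : Type*} [Field F] {A : GL (Fin 2) F} {D : ℕ} {g h : F[X]}

/-- The zeros of an invariant form are permuted by `A`, also when the starting point `(u : v)` is
infinity. -/
theorem binForm_row_eq_zero {k : F[X]} {c : F} (hk : k.natDegree ≤ D)
    (hkA : formAct D A k = C c * k) {u v : F} (h0 : binForm D k u v = 0)
    (hv : A.1 0 1 * u + A.1 1 1 * v ≠ 0) :
    binForm D k (A.1 0 0 * u + A.1 1 0 * v) (A.1 0 1 * u + A.1 1 1 * v) = 0 ∧
      k.IsRoot ((A.1 0 0 * u + A.1 1 0 * v) / (A.1 0 1 * u + A.1 1 1 * v)) := by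
  have h1 := binForm_formAct D A k u v
  rw [hkA, binForm_C_mul, h0, mul_zero] at h1
  refine ⟨h1.symm, ?_⟩
  have h2 := binForm_eq_pow_mul_aeval hk (A.1 0 0 * u + A.1 1 0 * v) hv
  rw [Algebra.algebraMap_self_apply, Algebra.algebraMap_self_apply,
    Algebra.algebraMap_self_apply, Algebra.algebraMap_self_apply] at h1
  rw [← h1, eq_comm, mul_eq_zero, coe_aeval_eq_eval] at h2
  exact h2.resolve_left (pow_ne_zero _ hv)

theorem eq_of_isRoot_of_irreducible {f : F[X]} (hf : Irreducible f) {x y : F} (hx : f.IsRoot x)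
    (hy : f.IsRoot y) : y = x := by
  have h1 := (irreducible_X_sub_C x).associated_of_dvd hf (dvd_iff_isRoot.2 hx)
  have h2 := hy.dvd h1.symm.dvd
  rwa [root_X_sub_C, eq_comm] at h2

/-- If the value `r` of `g / h` at infinity is a root of `G` then `g - r h` is a factor of the
transform of `G`. -/
theorem exists_homogAt_eq_mul {m : ℕ} {G : F[X]} (hG : G.natDegree ≤ m + 1)
    (hh : h.coeff D ≠ 0) (h0 : binForm (m + 1) G (g.coeff D) (h.coeff D) = 0) :
    ∃ G' : F[X], G'.natDegree ≤ m ∧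
      homogAt (m + 1) G g h = (g - C (g.coeff D / h.coeff D) * h) * homogAt m G' g h := by
  set r := g.coeff D / h.coeff D
  rw [binForm_eq_pow_mul_aeval hG _ hh, mul_eq_zero, coe_aeval_eq_eval] at h0
  obtain ⟨G', hG'⟩ := dvd_iff_isRoot.2 (h0.resolve_left (pow_ne_zero _ hh))
  have hdeg : G'.natDegree ≤ m := by
    by_cases hG0 : G' = 0
    · simp [hG0]
    · rw [hG', natDegree_mul (X_sub_C_ne_zero r) hG0, natDegree_X_sub_C] at hG
      omega
  refine ⟨G', hdeg, ?_⟩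
  rw [hG', homogAt_eq_binForm, add_comm m 1, binForm_mul (natDegree_X_sub_C r).le hdeg]
  congr 1
  simp [binForm, Finset.sum_range_succ, coeff_X, coeff_C]
  ring

/-- An irreducible transform of a polynomial of degree `m` has degree `D m`, provided that
infinity is either a pole of `g / h` or not a fixed point of `A`. In the second case a transform of
smaller degree is divisible by `g - r h`, where `r` is the value at infinity, and this factor
vanishes on the orbit of infinity, which has two further points if `D ≥ 3`. -/
theorem IsInvariantPair.natDegree_eq_of_isTransform (H : IsInvariantPair A D g h)
    (hD : D = orderOf (pglMk A)) (hA : h.coeff D = 0 ∨ A.1 0 1 ≠ 0) {m : ℕ} (hm : 2 < D * m)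
    {f : F[X]} (hf : Irreducible f) (hfm : IsTransform g h m f) : f.natDegree = D * m := by
  obtain ⟨G, hG, rfl⟩ := hfm
  have hD0 : 0 < D := Nat.pos_of_ne_zero (by rintro rfl; simp at hm)
  have hm0 : 0 < m := Nat.pos_of_ne_zero (by rintro rfl; simp at hm)
  refine le_antisymm (natDegree_homogAt_le H.natDegree_left H.natDegree_right _ _)
    (le_natDegree_of_ne_zero ?_)
  rw [coeff_homogAt H.natDegree_left H.natDegree_right]
  intro h0
  by_cases hh : h.coeff D = 0
  · rw [hh, binForm_zero_right, mul_eq_zero] at h0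
    refine h0.elim ?_ (pow_ne_zero _ (H.coeff_ne_zero.resolve_right (not_not.2 hh)))
    rw [← hG, Algebra.algebraMap_self_apply, coeff_natDegree, leadingCoeff_eq_zero]
    rintro rfl
    rw [natDegree_zero] at hG
    omega
  · have hb := hA.resolve_left hh
    obtain ⟨m, rfl⟩ : ∃ n, m = n + 1 := ⟨m - 1, by omega⟩
    obtain ⟨G', hG', hfac⟩ := exists_homogAt_eq_mul hG.le hh h0
    set k := g - C (g.coeff D / h.coeff D) * h with hk
    obtain ⟨c, hc, hcg, hch⟩ := H.formAct_eq
    have hkdeg : k.natDegree ≤ D := (natDegree_sub_le _ _).trans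
      (max_le H.natDegree_left ((natDegree_C_mul_le _ _).trans H.natDegree_right))
    have hkA : formAct D A k = C c * k := by
      have : formAct D A k = formAct D A g - formAct D A (C (g.coeff D / h.coeff D) * h) := by
        simp only [formAct, homogAt_eq_binForm, hk, binForm_sub]
      rw [this, formAct_C_mul, hcg, hch, hk]
      ring
    have hkD : binForm D k (1 : F) 0 = 0 := by
      rw [binForm_one_zero, hk, coeff_sub, coeff_C_mul, div_mul_cancel₀ _ hh, sub_self]
    obtain ⟨hk1, hroot1⟩ := binForm_row_eq_zero hkdeg hkA hkD (by simpa using hb)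
    simp only [mul_one, mul_zero, add_zero] at hk1 hroot1
    have hk_nu : ¬ IsUnit k := fun hu => not_isUnit_X_sub_C _
      (isUnit_of_dvd_unit (dvd_iff_isRoot.2 hroot1) hu)
    rw [hfac] at hf
    have hunit := (hf.isUnit_or_isUnit rfl).resolve_left hk_nu
    rcases Nat.eq_zero_or_pos m with rfl | hm1
    · -- here `D ≥ 3`, so the trace is nonzero and the second iterate of infinity is a second root
      have htr : A.1 0 0 + A.1 1 1 ≠ 0 := by
        intro htr
        have h2 : pglMk A ^ 2 = 1 := by
          rw [← pglMk_pow, pglMk_eq_one, pow_two, Units.val_mul]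
          simp only [Matrix.mul_apply, Fin.sum_univ_two]
          refine ⟨?_, ?_, ?_⟩
          · linear_combination A.1 0 1 * htr
          · linear_combination A.1 1 0 * htr
          · linear_combination (A.1 0 0 - A.1 1 1) * htr
        have := Nat.le_of_dvd two_pos (orderOf_dvd_of_pow_eq_one h2)
        omega
      have hv : A.1 0 1 * A.1 0 0 + A.1 1 1 * A.1 0 1 ≠ 0 := by
        rw [mul_comm (A.1 1 1), ← mul_add]
        exact mul_ne_zero hb htr
      obtain ⟨-, hroot2⟩ := binForm_row_eq_zero hkdeg hkA hk1 hv
      have heq := eq_of_isRoot_of_irreducible hf (root_mul_right_of_isRoot _ hroot1)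
        (root_mul_right_of_isRoot _ hroot2)
      rw [div_eq_div_iff hv hb] at heq
      refine mul_ne_zero hb (det_ne_zero_fin_two A) ?_
      linear_combination -heq
    · -- the cofactor is a unit, so its coefficient of `X ^ (D m)` vanishes and `k` divides it too
      have hcoeff : binForm m G' (g.coeff D) (h.coeff D) = 0 := by
        rw [← coeff_homogAt H.natDegree_left H.natDegree_right]
        refine coeff_eq_zero_of_natDegree_lt ?_
        rw [natDegree_eq_zero_of_isUnit hunit]
        positivity
      obtain ⟨m, rfl⟩ : ∃ n, m = n + 1 := ⟨m - 1, by omega⟩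
      obtain ⟨G'', -, hfac'⟩ := exists_homogAt_eq_mul hG' hh hcoeff
      exact hk_nu (isUnit_of_dvd_unit ⟨_, hfac'⟩ hunit)

end Degree

/-! ### Existence of explicit pairs -/

section Existence

variable {F : Type*} [Field F]

theorem exists_GL_eq (M : Matrix (Fin 2) (Fin 2) F)
    (hM : M 0 0 * M 1 1 - M 0 1 * M 1 0 ≠ 0) : ∃ P : GL (Fin 2) F, P.1 = M := by
  rw [← Matrix.det_fin_two] at hM
  exact ⟨Matrix.GeneralLinearGroup.mkOfDetNeZero M hM, rfl⟩

theorem pglMk_eq_conj {A P R : GL (Fin 2) F} {s : F} (hs : s ≠ 0)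
    (h : A.1 * P.1 = s • (P.1 * R.1)) : pglMk A = pglMk P * pglMk R * (pglMk P)⁻¹ := by
  rw [eq_mul_inv_iff_mul_eq, ← pglMk_mul, ← pglMk_mul, eq_comm, pglMk_eq_pglMk]
  exact ⟨s, hs, fun i j => congrFun (congrFun h i) j⟩

theorem charpoly_eq_of_roots {K : Type*} [Field K] (M : Matrix (Fin 2) (Fin 2) K) {α β : K}
    (htr : α + β = M 0 0 + M 1 1) (hdet : α * β = M 0 0 * M 1 1 - M 0 1 * M 1 0) :
    M.charpoly = (X - C α) * (X - C β) := by
  rw [Matrix.charpoly_fin_two, Matrix.trace_fin_two, Matrix.det_fin_two, ← htr, ← hdet, C_add,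
    C_mul]
  ring

/-- The case where infinity is a fixed point of `A`: the conjugating matrix is chosen to fix
infinity too, which then is a pole of the rational function. -/
theorem exists_isExplicitPair_of_eq_zero [Finite F] (A : GL (Fin 2) F) (hb : A.1 0 1 = 0) :
    ∃ (t : PGLType) (g h : F[X]), HasType A t ∧ IsExplicitPair t A g h ∧
      h.coeff (orderOf (pglMk A)) = 0 := by
  have hA := det_ne_zero_fin_two A
  rw [hb, zero_mul, sub_zero] at hA
  have ha := left_ne_zero_of_mul hA
  have hd := right_ne_zero_of_mul hA
  have hpole : ∀ P : GL (Fin 2) F, P.1 0 1 = 0 →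
      (homogAt (orderOf (pglMk A)) 1 (topForm P) (botForm P)).coeff (orderOf (pglMk A)) = 0 := by
    intro P hP
    have h1 := binForm_formAct (orderOf (pglMk A)) P 1 (1 : F) 0
    have h2 : (1 : F[X]).coeff (orderOf (pglMk A)) = 0 :=
      coeff_eq_zero_of_natDegree_lt (by simpa using orderOf_pglMk_pos A)
    rw [hP, binForm_one_zero] at h1
    rw [formAct] at h1
    simp [h1, binForm_zero_right, h2]
  by_cases had : A.1 0 0 = A.1 1 1
  · by_cases hc : A.1 1 0 = 0
    · have h1 : pglMk A = 1 := pglMk_eq_one.2 ⟨hb, hc, had⟩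
      exact ⟨.zero, _, _, h1, ⟨1, 1, X, 1, by rw [h1, pglMk_one]; simp, ⟨rfl, rfl, rfl⟩, rfl, rfl⟩,
        hpole 1 (by simp)⟩
    · obtain ⟨R, hR⟩ := exists_GL_eq (!![1, 0; 1, 1] : Matrix (Fin 2) (Fin 2) F) (by simp)
      obtain ⟨P, hP⟩ := exists_GL_eq !![1, 0; 0, A.1 1 0 / A.1 0 0] (by simp [ha, hc])
      refine ⟨.two, _, _, ⟨fun h => hc (pglMk_eq_one.1 h).2.1, A.1 0 0, ?_⟩,
        ⟨R, P, _, 1, pglMk_eq_conj ha ?_, ⟨hR, rfl, rfl⟩, rfl, rfl⟩, hpole P (by simp [hP])⟩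
      · rw [pow_two]
        exact charpoly_eq_of_roots _ (by rw [← had]) (by rw [← had, hb]; ring)
      · rw [hP, hR]
        ext i j
        fin_cases i <;> fin_cases j <;> simp [Matrix.mul_apply, Fin.sum_univ_two, hb, ← had]
        field_simp
  · have had' : A.1 0 0 - A.1 1 1 ≠ 0 := sub_ne_zero.2 had
    obtain ⟨R, hR⟩ := exists_GL_eq !![A.1 0 0 / A.1 1 1, 0; 0, 1] (by simp [ha, hd])
    obtain ⟨P, hP⟩ := exists_GL_eq !![1, 0; A.1 1 0 / (A.1 0 0 - A.1 1 1), 1] (by simp)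
    refine ⟨.one, _, _, ⟨A.1 0 0, A.1 1 1, had, ?_⟩, ⟨R, P, _, 1, pglMk_eq_conj hd ?_,
      ⟨_, by rwa [Ne, div_eq_one_iff_eq hd], hR, rfl, rfl⟩, rfl, rfl⟩, hpole P (by simp [hP])⟩
    · exact charpoly_eq_of_roots _ rfl (by rw [hb]; ring)
    · rw [hP, hR]
      ext i j
      fin_cases i <;> fin_cases j <;> simp [Matrix.mul_apply, Fin.sum_univ_two, hb] <;>
        field_simp
      ring

/-- The case where infinity is not a fixed point of `A`. If the characteristic polynomial splits,
the conjugating matrix is built from the eigenvectors `(b, α - a)`; otherwise its second column is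
the vector `(0, 1)`, which is cyclic because `b ≠ 0`. -/
theorem exists_isExplicitPair_of_ne_zero [Finite F] (A : GL (Fin 2) F) (hb : A.1 0 1 ≠ 0) :
    ∃ (t : PGLType) (g h : F[X]), HasType A t ∧ IsExplicitPair t A g h := by
  have hA := det_ne_zero_fin_two A
  by_cases hroot : ∃ α : F,
      α ^ 2 - (A.1 0 0 + A.1 1 1) * α + (A.1 0 0 * A.1 1 1 - A.1 0 1 * A.1 1 0) = 0
  · obtain ⟨α, hα⟩ := hroot
    obtain ⟨β, hβ⟩ : ∃ β, β = A.1 0 0 + A.1 1 1 - α := ⟨_, rfl⟩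
    have htr : α + β = A.1 0 0 + A.1 1 1 := by rw [hβ]; ring
    have hdet : α * β = A.1 0 0 * A.1 1 1 - A.1 0 1 * A.1 1 0 := by
      rw [hβ]
      linear_combination -hα
    have hα0 : α ≠ 0 := left_ne_zero_of_mul (hdet ▸ hA)
    have hβ0 : β ≠ 0 := right_ne_zero_of_mul (hdet ▸ hA)
    have hchar := charpoly_eq_of_roots A.1 htr hdet
    have hd : A.1 1 1 = α + β - A.1 0 0 := by rw [htr]; ring
    -- the second row of `A`, applied to the eigenvectors `(b, α - a)` and `(b, β - a)`
    have hc : A.1 1 0 * A.1 0 1 = A.1 0 0 * A.1 1 1 - α * β := by rw [hdet]; ring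
    by_cases hαβ : α = β
    · subst hαβ
      obtain ⟨R, hR⟩ := exists_GL_eq (!![1, 0; 1, 1] : Matrix (Fin 2) (Fin 2) F) (by simp)
      obtain ⟨P, hP⟩ := exists_GL_eq !![0, A.1 0 1; α, α - A.1 0 0] (by simp [hα0, hb])
      refine ⟨.two, _, _, ⟨fun h => hb (pglMk_eq_one.1 h).1, α, by rw [hchar, pow_two]⟩,
        ⟨R, P, _, 1, pglMk_eq_conj hα0 ?_, ⟨hR, rfl, rfl⟩, rfl, rfl⟩⟩
      rw [hP, hR]
      ext i j
      fin_cases i <;> fin_cases j <;> simp [Matrix.mul_apply, Fin.sum_univ_two]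
      · ring
      · ring
      · rw [hd]
        ring
      · rw [hc, hd]
        ring
    · obtain ⟨R, hR⟩ := exists_GL_eq !![α / β, 0; 0, 1] (by simp [hα0, hβ0])
      obtain ⟨P, hP⟩ := exists_GL_eq !![A.1 0 1, A.1 0 1; α - A.1 0 0, β - A.1 0 0] (by
        have : A.1 0 1 * (β - A.1 0 0) - A.1 0 1 * (α - A.1 0 0) = A.1 0 1 * (β - α) := by ring
        simp only [Matrix.of_apply, Matrix.cons_val', Matrix.cons_val_zero, Matrix.cons_val_one,
          Matrix.cons_val_fin_one, this]
        exact mul_ne_zero hb (sub_ne_zero.2 (Ne.symm hαβ)))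
      refine ⟨.one, _, _, ⟨α, β, hαβ, hchar⟩, ⟨R, P, _, 1, pglMk_eq_conj hβ0 ?_,
        ⟨_, by rwa [Ne, div_eq_one_iff_eq hβ0], hR, rfl, rfl⟩, rfl, rfl⟩⟩
      rw [hP, hR]
      ext i j
      fin_cases i <;> fin_cases j <;> simp [Matrix.mul_apply, Fin.sum_univ_two]
      · field_simp
        ring
      · ring
      · rw [hc, hd]
        field_simp
        ring
      · rw [hc, hd]
        ring
  · set K := AlgebraicClosure F
    obtain ⟨α, hα⟩ : ∃ α : K, α ^ 2 - algebraMap F K (A.1 0 0 + A.1 1 1) * α +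
        algebraMap F K (A.1 0 0 * A.1 1 1 - A.1 0 1 * A.1 1 0) = 0 := by
      obtain ⟨α, hα⟩ := IsAlgClosed.exists_aeval_eq_zero K A.1.charpoly (by
        rw [Matrix.charpoly_degree_eq_dim]
        simp)
      refine ⟨α, ?_⟩
      rw [Matrix.charpoly_fin_two, Matrix.trace_fin_two, Matrix.det_fin_two] at hα
      simpa using hα
    have hαF : α ∉ Set.range (algebraMap F K) := by
      rintro ⟨x, rfl⟩
      refine hroot ⟨x, ?_⟩
      rw [← map_pow, ← map_mul, ← map_sub, ← map_add] at hα
      exact (map_eq_zero _).1 hα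
    have hchar : ∀ β : K, α + β = algebraMap F K (A.1 0 0 + A.1 1 1) →
        A.1.charpoly.map (algebraMap F K) = (X - C α) * (X - C β) := by
      intro β hβ
      rw [← Matrix.charpoly_map]
      refine charpoly_eq_of_roots _ (by simpa using hβ) ?_
      simp only [map_add, map_sub, map_mul, Matrix.map_apply] at hα hβ ⊢
      linear_combination α * hβ - hα
    by_cases ht : A.1 0 0 + A.1 1 1 = 0
    · have hns : ¬ IsSquare (-(A.1 0 0 * A.1 1 1 - A.1 0 1 * A.1 1 0)) := by
        rintro ⟨r, hr⟩
        exact hroot ⟨r, by rw [ht]; linear_combination -hr⟩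
      obtain ⟨R, hR⟩ := exists_GL_eq
        !![0, 1; -(A.1 0 0 * A.1 1 1 - A.1 0 1 * A.1 1 0), 0] (by simpa using hA)
      obtain ⟨P, hP⟩ := exists_GL_eq !![A.1 0 1, 0; A.1 1 1, 1] (by simpa using hb)
      refine ⟨.three, _, _, ⟨α, hαF, hchar _ (by rw [ht]; simp)⟩,
        ⟨R, P, _, _, pglMk_eq_conj one_ne_zero ?_, ⟨_, hns, hR, rfl, rfl⟩, rfl, rfl⟩⟩
      rw [hP, hR, one_smul]
      ext i j
      fin_cases i <;> fin_cases j <;> simp [Matrix.mul_apply, Fin.sum_univ_two]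
      · linear_combination A.1 0 1 * ht
      · linear_combination A.1 1 1 * ht
    · set t := A.1 0 0 + A.1 1 1 with ht_def
      set Δ := A.1 0 0 * A.1 1 1 - A.1 0 1 * A.1 1 0 with hΔ
      have hirr : Irreducible (X ^ 2 - X - C (-Δ / t ^ 2) : F[X]) := by
        have hdeg : (X ^ 2 - X - C (-Δ / t ^ 2) : F[X]).natDegree = 2 := by compute_degree!
        refine irreducible_of_degree_le_three_of_not_isRoot (by simp [hdeg]) fun x hx => ?_
        refine hroot ⟨t * x, ?_⟩
        have hx' : x ^ 2 - x - -Δ / t ^ 2 = 0 := by simpa using hx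
        field_simp at hx'
        linear_combination hx'
      obtain ⟨θ, hθ⟩ := IsAlgClosed.exists_aeval_eq_zero K _ (degree_pos_of_irreducible hirr).ne'
      replace hθ : θ ^ 2 - θ - algebraMap F K (-Δ / t ^ 2) = 0 := by simpa using hθ
      obtain ⟨g, h, hg, hh⟩ := exists_map_eq_of_roots hθ (pow_card_isRoot hθ)
        (fun e => not_mem_range_of_irreducible hirr hθ (mem_range_of_pow_card_eq e))
        (orderOf (pglMk A))
      obtain ⟨R, hR⟩ := exists_GL_eq !![0, 1; -Δ / t ^ 2, 1] (by simp [hA, ht])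
      obtain ⟨P, hP⟩ := exists_GL_eq !![A.1 0 1 / t, 0; A.1 1 1 / t - 1, 1] (by simp [hb, ht])
      refine ⟨.four, _, _, ⟨α, algebraMap F K t - α, hαF, fun e => ht ?_, hchar _ (by ring)⟩,
        ⟨R, P, g, h, pglMk_eq_conj ht ?_, ⟨_, hirr, hR, θ, hθ, hg, hh⟩, rfl, rfl⟩⟩
      · have : algebraMap F K t = 0 := by linear_combination e
        exact (map_eq_zero _).1 this
      · rw [hP, hR]
        ext i j
        fin_cases i <;> fin_cases j <;> simp [Matrix.mul_apply, Fin.sum_univ_two]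
        · field_simp
          rw [ht_def]
          ring
        · field_simp
        · field_simp
          rw [hΔ, ht_def]
          ring
        · field_simp

end Existence

theorem mainTheorem2 {F : Type*} [Field F] [Finite F] (A : GL (Fin 2) F) (D : ℕ)
    (hD : D = orderOf (pglMk A)) :
    (∃ (t : PGLType) (g h : F[X]), HasType A t ∧ IsExplicitPair t A g h ∧
      IsCoprime g h ∧ max g.natDegree h.natDegree = D ∧
      ∀ m : ℕ, 2 < D * m →
        {f : F[X] | IsInvariantOfDegree (pglMk A) (D * m) f} =
          {f : F[X] | f.Monic ∧ Irreducible f ∧ IsTransform g h m f}) ∧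
    (∀ (t : PGLType) (g h : F[X]), IsExplicitPair t A g h →
      IsCoprime g h ∧ max g.natDegree h.natDegree = D ∧
      ∀ m : ℕ, 2 < D * m → ∀ f : F[X], f.Monic → Irreducible f → f.natDegree = D * m →
        (pglComp (pglMk A) f = f ↔ IsTransform g h m f)) := by
  refine ⟨?_, fun t g h H => ?_⟩
  · obtain ⟨t, g, h, ht, hgh, hinf⟩ : ∃ (t : PGLType) (g h : F[X]), HasType A t ∧
        IsExplicitPair t A g h ∧ (h.coeff D = 0 ∨ A.1 0 1 ≠ 0) := by
      by_cases hb : A.1 0 1 = 0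
      · obtain ⟨t, g, h, h1, h2, h3⟩ := exists_isExplicitPair_of_eq_zero A hb
        exact ⟨t, g, h, h1, h2, Or.inl (hD ▸ h3)⟩
      · obtain ⟨t, g, h, h1, h2⟩ := exists_isExplicitPair_of_ne_zero A hb
        exact ⟨t, g, h, h1, h2, Or.inr hb⟩
    have H := hgh.isInvariantPair
    rw [← hD] at H
    refine ⟨t, g, h, ht, hgh, H.isCoprime, H.max_natDegree, fun m hm => Set.ext fun f => ?_⟩
    constructor
    · rintro ⟨hmon, hirr, hdeg, hinv⟩
      exact ⟨hmon, hirr, (H.pglComp_eq_self_iff hD hm hmon hirr hdeg).1 hinv⟩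
    · rintro ⟨hmon, hirr, htrans⟩
      have hdeg := H.natDegree_eq_of_isTransform hD hinf hm hirr htrans
      exact ⟨hmon, hirr, hdeg, (H.pglComp_eq_self_iff hD hm hmon hirr hdeg).2 htrans⟩
  · have H := H.isInvariantPair
    rw [← hD] at H
    exact ⟨H.isCoprime, H.max_natDegree, fun m hm f hmon hirr hdeg =>
      H.pglComp_eq_self_iff hD hm hmon hirr hdeg⟩
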